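/- **Theorem (Long Exact Sequence in Homotopy).** A *semi-coarse space* is a set $X$ with a family $\mathcal V$ of subsets of $X\times X$ (the *controlled sets*) that contains the diagonal and is closed under subsets, finite unions and inverses. A map is *bornologous* if its square carries controlled sets to controlled sets. A subset $A\subset X$ carries the structure $\{V\cap(A\times A) : V\in\mathcal V\}$, and the controlled sets of a product are the subsets of finite unions of products of controlled sets. The controlled sets of $\mathbb Z$ are the subsets of $\{(a,b) : |a-b|\le 1\}$. Let $I_m=\{0,\dots,m\}\subset\mathbb Z$, let $\partial I_m^n$ be the set of points of $I_m^n$ with some coordinate in $\{0,m\}$, and let $J_m^{n-1}$ be the set of those $x\in\partial I_m^n$ such that if $x_n=0$ then $x_i\in\{0,m\}$ for some $i\ne n$. For $n\ge 1$ and a point $*\in A\subset X$, let $$\pi_n^{sc}(X,A)=\varinjlim_{m\ge 1}\,[(I_m^n,\partial I_m^n,J_m^{n-1}),(X,A,*)],$$ where the brackets denote bornologous maps of triples modulo homotopy of maps of triples, a homotopy from $f$ to $g$ being a bornologous map $H$ on $I_m^n\times\mathbb Z$ that equals $f$ at all sufficiently negative times and $g$ at all sufficiently positive times, and that carries $\partial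 I_m^n\times\mathbb Z$ into $A$ and $J_m^{n-1}\times\mathbb Z$ into $\{*\}$. The transition maps are given by composition with the coordinatewise truncation $x_i\mapsto\min(x_i,m)$. Write $\langle f\rangle$ for the class of $f$, and put $\pi_n^{sc}(X,*)=\pi_n^{sc}(X,\{*\})$. Juxtaposition of maps along the first coordinate makes $\pi_n^{sc}(X,*)$ for $n\ge1$ and $\pi_n^{sc}(X,A)$ for $n\ge 2$ into groups; $\pi_1^{sc}(X,A)$ is a set pointed by the class of the constant map. Let $(X,\mathcal V)$ be a semi-coarse space and $*\in A\subset X$, and let $i_*$ and $j_*$ be the maps induced by the inclusions $i:(A,*)\to(X,*)$ and $j:(X,*)\to(X,A)$. Then for every $n\ge 2$ there is a group homomorphism $$\partial_n:\pi_n^{sc}(X,A)\to\pi_{n-1}^{sc}(A,*),\qquad \partial_n\langle f\rangle=\langle f|_{I_m^{n-1}\times\{0\}}\rangle \text{ for } f \text{ on } I_m^n,$$ and with these homomorphisms the sequence $$\cdots\xrightarrow{j_*}\pi_{n+1}^{sc}(X,A)\xrightarrow{\partial_{n+1}}\pi_n^{sc}(A,*)\xrightarrow{i_*}\pi_n^{sc}(X,*)\xrightarrow{j_*}\pi_n^{sc}(X,A)\xrightarrow{\partial_n}\cdots\xrightarrow{\partial_2}\pi_1^{sc}(A,*)\xrightarrow{i_*}\pi_1^{sc}(X,*)\xrightarrow{j_*}\pi_1^{sc}(X,A)$$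 is exact at every term except the last, that is, at each of these terms the image of the incoming map is the preimage of the identity element (at $\pi_1^{sc}(X,*)$, of the base point) under the outgoing map. -/

import Mathlib

/-- A semi-coarse structure on `X`: a family of controlled subsets of `X × X` containing the
diagonal and closed under subsets, binary unions and inverses. -/
class SemiCoarseSpace (X : Type*) where
  IsControlled : Set (X × X) → Prop
  diagonal : IsControlled (Set.diagonal X)
  subset : ∀ {U V : Set (X × X)}, IsControlled V → U ⊆ V → IsControlled U
  union : ∀ {U V : Set (X × X)}, IsControlled U → IsControlled V → IsControlled (U ∪ V)
  inv : ∀ {U : Set (X × X)}, IsControlled U → IsControlled (Prod.swap ⁻¹' U)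

namespace SemiCoarse

open SemiCoarseSpace Set

section Spaces

variable {X Y Z : Type*} [SemiCoarseSpace X] [SemiCoarseSpace Y] [SemiCoarseSpace Z]

theorem controlled_iUnion {k : ℕ} (V : Fin k → Set (X × X)) (h : ∀ j, IsControlled (V j)) :
    IsControlled (⋃ j, V j) := by
  induction k with
  | zero => exact subset diagonal (by simp)
  | succ k ih =>
    refine subset (union (h 0) (ih (fun j => V j.succ) fun j => h j.succ)) ?_
    intro p hp
    obtain ⟨j, hj⟩ := mem_iUnion.1 hp
    rcases Fin.eq_zero_or_eq_succ j with rfl | ⟨i, rfl⟩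
    · exact Or.inl hj
    · exact Or.inr (mem_iUnion.2 ⟨i, hj⟩)

theorem controlled_of_finite {S : Set (X × X)} (hS : S.Finite)
    (h : ∀ p ∈ S, IsControlled {p}) : IsControlled S := by
  induction S, hS using Set.Finite.induction_on with
  | empty => exact subset diagonal (empty_subset _)
  | @insert a s _ _ ih =>
    rw [insert_eq]
    exact union (h a (mem_insert _ _)) (ih fun p hp => h p (mem_insert_of_mem _ hp))

/-- A map is bornologous if it carries controlled sets to controlled sets. -/
def Bornologous (f : X → Y) : Prop :=
  ∀ U : Set (X × X), IsControlled U → IsControlled (Prod.map f f '' U)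

theorem Bornologous.comp {g : Y → Z} {f : X → Y} (hg : Bornologous g) (hf : Bornologous f) :
    Bornologous (g ∘ f) := by
  intro U hU
  refine subset (hg _ (hf U hU)) ?_
  rintro _ ⟨p, hp, rfl⟩
  exact ⟨_, ⟨p, hp, rfl⟩, rfl⟩

theorem bornologous_id : Bornologous (id : X → X) := fun U hU => by simpa using hU

/-- The subspace structure: the traces `V ∩ (A × A)` of the controlled sets `V` of `X`. -/
instance subspace (A : Set X) : SemiCoarseSpace A where
  IsControlled U := ∃ V : Set (X × X), IsControlled V ∧
    U = {p | ((p.1 : X), (p.2 : X)) ∈ V}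
  diagonal := ⟨_, diagonal, by ext ⟨a, b⟩; simp [Subtype.ext_iff]⟩
  subset := by
    rintro U _ ⟨V, hV, rfl⟩ hU
    refine ⟨(fun p : A × A => ((p.1 : X), (p.2 : X))) '' U, subset hV ?_, ?_⟩
    · rintro _ ⟨p, hp, rfl⟩
      exact hU hp
    · ext ⟨a, b⟩
      simp
  union := by
    rintro _ _ ⟨V, hV, rfl⟩ ⟨W, hW, rfl⟩
    exact ⟨V ∪ W, union hV hW, rfl⟩
  inv := by
    rintro _ ⟨V, hV, rfl⟩
    exact ⟨_, inv hV, rfl⟩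

/-- The canonical structure on `ℤ`: the controlled sets are the subsets of
`⋃ z, {(z, z - 1), (z, z), (z, z + 1)}`. -/
instance int : SemiCoarseSpace ℤ where
  IsControlled U := U ⊆ {p | |p.1 - p.2| ≤ 1}
  diagonal := by rintro ⟨a, b⟩ h; simp_all
  subset h h' := h'.trans h
  union h h' := union_subset h h'
  inv := by
    intro U h p hp
    have := h hp
    simpa [abs_sub_comm] using this

/-- The product structure: the controlled sets are the subsets of finite unions of sets
`V ⊠ W = {((a, b), (c, d)) | (a, c) ∈ V, (b, d) ∈ W}` with `V` and `W` controlled. -/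
instance prod : SemiCoarseSpace (X × Y) where
  IsControlled U := ∃ (k : ℕ) (V : Fin k → Set (X × X)) (W : Fin k → Set (Y × Y)),
    (∀ j, IsControlled (V j)) ∧ (∀ j, IsControlled (W j)) ∧
      U ⊆ ⋃ j, {p | (p.1.1, p.2.1) ∈ V j ∧ (p.1.2, p.2.2) ∈ W j}
  diagonal := ⟨1, fun _ => Set.diagonal X, fun _ => Set.diagonal Y, fun _ => diagonal,
    fun _ => diagonal, by rintro ⟨⟨a, b⟩, c, d⟩ h; simp_all⟩
  subset := by
    rintro U U' ⟨k, V, W, hV, hW, h⟩ hU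
    exact ⟨k, V, W, hV, hW, hU.trans h⟩
  union := by
    rintro U U' ⟨k, V, W, hV, hW, h⟩ ⟨k', V', W', hV', hW', h'⟩
    refine ⟨k + k', Fin.append V V', Fin.append W W', ?_, ?_, ?_⟩
    · intro j
      refine Fin.addCases (fun i => ?_) (fun i => ?_) j <;> simp [hV, hV']
    · intro j
      refine Fin.addCases (fun i => ?_) (fun i => ?_) j <;> simp [hW, hW']
    · rintro p (hp | hp)
      · obtain ⟨j, hj⟩ := mem_iUnion.1 (h hp)
        exact mem_iUnion.2 ⟨Fin.castAdd k' j, by simpa using hj⟩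
      · obtain ⟨j, hj⟩ := mem_iUnion.1 (h' hp)
        exact mem_iUnion.2 ⟨Fin.natAdd k j, by simpa using hj⟩
  inv := by
    rintro U ⟨k, V, W, hV, hW, h⟩
    refine ⟨k, fun j => Prod.swap ⁻¹' V j, fun j => Prod.swap ⁻¹' W j,
      fun j => inv (hV j), fun j => inv (hW j), ?_⟩
    intro p hp
    simpa using h hp

/-- The product of `n` copies of `X`: the controlled sets are the subsets of finite unions of
`n`-fold products `V 0 ⊠ ⋯ ⊠ V (n - 1)` of controlled sets. -/
instance power (n : ℕ) : SemiCoarseSpace (Fin n → X) where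
  IsControlled U := ∃ (k : ℕ) (V : Fin k → Fin n → Set (X × X)),
    (∀ j i, IsControlled (V j i)) ∧ U ⊆ ⋃ j, {p | ∀ i, (p.1 i, p.2 i) ∈ V j i}
  diagonal := ⟨1, fun _ _ => Set.diagonal X, fun _ _ => diagonal,
    by rintro ⟨a, b⟩ h; simp_all⟩
  subset := by
    rintro U U' ⟨k, V, hV, h⟩ hU
    exact ⟨k, V, hV, hU.trans h⟩
  union := by
    rintro U U' ⟨k, V, hV, h⟩ ⟨k', V', hV', h'⟩
    refine ⟨k + k', Fin.append V V', ?_, ?_⟩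
    · intro j
      refine Fin.addCases (fun i => ?_) (fun i => ?_) j <;> simp [hV, hV']
    · rintro p (hp | hp)
      · obtain ⟨j, hj⟩ := mem_iUnion.1 (h hp)
        exact mem_iUnion.2 ⟨Fin.castAdd k' j, by simpa using hj⟩
      · obtain ⟨j, hj⟩ := mem_iUnion.1 (h' hp)
        exact mem_iUnion.2 ⟨Fin.natAdd k j, by simpa using hj⟩
  inv := by
    rintro U ⟨k, V, hV, h⟩
    refine ⟨k, fun j i => Prod.swap ⁻¹' V j i, fun j i => inv (hV j i), ?_⟩
    intro p hp
    simpa using h hp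

theorem bornologous_val (A : Set X) : Bornologous (Subtype.val : A → X) := by
  rintro _ ⟨V, hV, rfl⟩
  refine subset hV ?_
  rintro _ ⟨p, hp, rfl⟩
  exact hp

theorem bornologous_fst : Bornologous (Prod.fst : X × Y → X) := by
  rintro U ⟨k, V, W, hV, hW, h⟩
  refine subset (controlled_iUnion V hV) ?_
  rintro _ ⟨p, hp, rfl⟩
  obtain ⟨j, hj⟩ := mem_iUnion.1 (h hp)
  exact mem_iUnion.2 ⟨j, hj.1⟩

theorem bornologous_snd : Bornologous (Prod.snd : X × Y → Y) := by
  rintro U ⟨k, V, W, hV, hW, h⟩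
  refine subset (controlled_iUnion W hW) ?_
  rintro _ ⟨p, hp, rfl⟩
  obtain ⟨j, hj⟩ := mem_iUnion.1 (h hp)
  exact mem_iUnion.2 ⟨j, hj.2⟩

theorem Bornologous.prodMk {f : Z → X} {g : Z → Y} (hf : Bornologous f) (hg : Bornologous g) :
    Bornologous fun z => (f z, g z) := by
  intro U hU
  refine ⟨1, fun _ => _, fun _ => _, fun _ => hf U hU, fun _ => hg U hU, ?_⟩
  rintro _ ⟨p, hp, rfl⟩
  exact mem_iUnion.2 ⟨0, ⟨p, hp, rfl⟩, ⟨p, hp, rfl⟩⟩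

theorem bornologous_apply {n : ℕ} (i : Fin n) : Bornologous fun x : Fin n → X => x i := by
  rintro U ⟨k, V, hV, h⟩
  refine subset (controlled_iUnion (fun j => V j i) fun j => hV j i) ?_
  rintro _ ⟨p, hp, rfl⟩
  obtain ⟨j, hj⟩ := mem_iUnion.1 (h hp)
  exact mem_iUnion.2 ⟨j, hj i⟩

theorem Bornologous.pi {n : ℕ} {f : Z → Fin n → X} (hf : ∀ i, Bornologous fun z => f z i) :
    Bornologous f := by
  intro U hU
  refine ⟨1, fun _ i => _, fun _ i => hf i U hU, ?_⟩
  rintro _ ⟨p, hp, rfl⟩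
  exact mem_iUnion.2 ⟨0, fun i => ⟨p, hp, rfl⟩⟩

theorem Bornologous.codRestrict {f : X → Y} (hf : Bornologous f) {B : Set Y}
    (h : ∀ x, f x ∈ B) : Bornologous fun x => (⟨f x, h x⟩ : B) := by
  intro U hU
  refine ⟨_, hf U hU, ?_⟩
  ext ⟨⟨a, ha⟩, ⟨b, hb⟩⟩
  simp only [mem_image, mem_ofPred_eq, Prod.exists, Prod.map_apply, Prod.mk.injEq, Subtype.mk.injEq]

theorem bornologous_neg : Bornologous fun z : ℤ => -z := by
  rintro U hU _ ⟨⟨a, b⟩, hp, rfl⟩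
  have := hU hp
  simp only [mem_ofPred_eq, Prod.map_apply] at this ⊢
  rw [abs_le] at *
  omega

theorem bornologous_add (c : ℤ) : Bornologous fun z : ℤ => z + c := by
  rintro U hU _ ⟨⟨a, b⟩, hp, rfl⟩
  have := hU hp
  simpa using this

theorem bornologous_const (y : Y) : Bornologous fun _ : X => y := by
  intro U _
  refine subset diagonal ?_
  rintro _ ⟨p, hp, rfl⟩
  simp

theorem bornologous_of_finite_range {f : X → Y} (hfin : (range f).Finite)
    (h : ∀ x y, IsControlled {(x, y)} → IsControlled {(f x, f y)}) : Bornologous f := by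
  intro U hU
  refine controlled_of_finite ((hfin.prod hfin).subset ?_) ?_
  · rintro _ ⟨p, hp, rfl⟩
    exact ⟨mem_range_self _, mem_range_self _⟩
  · rintro _ ⟨p, hp, rfl⟩
    exact h _ _ (subset hU (by simpa using hp))

theorem Bornologous.adj {f : X → Y} (hf : Bornologous f) {x y : X}
    (h : IsControlled {(x, y)}) : IsControlled {(f x, f y)} := by
  simpa using hf _ h

end Spaces

section Triples

variable {X Y Z : Type*} [SemiCoarseSpace X] [SemiCoarseSpace Y] [SemiCoarseSpace Z]

/-- Bornologous maps of triples `(X, A, B) → (Y, C, D)`. -/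
structure TripleMap (A B : Set X) (C D : Set Y) where
  toFun : X → Y
  bornologous : Bornologous toFun
  mapsTo_fst : MapsTo toFun A C
  mapsTo_snd : MapsTo toFun B D

instance (A B : Set X) (C D : Set Y) : CoeFun (TripleMap A B C D) fun _ => X → Y :=
  ⟨TripleMap.toFun⟩

variable {A B : Set X} {C D : Set Y} {E F : Set Z}

@[ext] theorem TripleMap.ext {f g : TripleMap A B C D} (h : ∀ x, f x = g x) : f = g := by
  cases f; cases g
  simp only [TripleMap.mk.injEq]
  exact funext h

/-- Composition of maps of triples. -/
def TripleMap.comp (g : TripleMap C D E F) (f : TripleMap A B C D) : TripleMap A B E F where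
  toFun := g ∘ f
  bornologous := g.bornologous.comp f.bornologous
  mapsTo_fst := g.mapsTo_fst.comp f.mapsTo_fst
  mapsTo_snd := g.mapsTo_snd.comp f.mapsTo_snd

/-- Homotopy of maps of triples: a bornologous map `H` on `X × ℤ` that equals `f` far to the left,
`g` far to the right, and carries `A × ℤ` into `C` and `B × ℤ` into `D`. -/
def Homotopic (f g : TripleMap A B C D) : Prop :=
  ∃ H : X × ℤ → Y, Bornologous H ∧
    (∃ M N : ℤ, M < N ∧ (∀ x, ∀ z ≤ M, H (x, z) = f x) ∧ ∀ x, ∀ z ≥ N, H (x, z) = g x) ∧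
    (∀ x ∈ A, ∀ z, H (x, z) ∈ C) ∧ ∀ x ∈ B, ∀ z, H (x, z) ∈ D

theorem Homotopic.refl (f : TripleMap A B C D) : Homotopic f f :=
  ⟨fun p => f p.1, f.bornologous.comp bornologous_fst,
    ⟨0, 1, by norm_num, fun _ _ _ => rfl, fun _ _ _ => rfl⟩,
    fun _ hx _ => f.mapsTo_fst hx, fun _ hx _ => f.mapsTo_snd hx⟩

theorem Homotopic.symm {f g : TripleMap A B C D} : Homotopic f g → Homotopic g f := by
  rintro ⟨H, hH, ⟨M, N, hMN, hf, hg⟩, hA, hB⟩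
  refine ⟨fun p => H (p.1, -p.2),
    hH.comp (bornologous_fst.prodMk (bornologous_neg.comp bornologous_snd)),
    ⟨-N, -M, by omega, fun x z hz => hg x _ (by omega), fun x z hz => hf x _ (by omega)⟩,
    fun x hx z => hA x hx _, fun x hx z => hB x hx _⟩

theorem Homotopic.trans {f g h : TripleMap A B C D} :
    Homotopic f g → Homotopic g h → Homotopic f h := by
  rintro ⟨H, hH, ⟨M, N, hMN, hf, hg⟩, hA, hB⟩ ⟨H', hH', ⟨M', N', hMN', hf', hg'⟩, hA', hB'⟩
  have hK : Bornologous fun p : X × ℤ => H' (p.1, p.2 + (M' - N)) :=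
    hH'.comp (bornologous_fst.prodMk ((bornologous_add _).comp bornologous_snd))
  have key : ∀ x z, N ≤ z → z ≤ N → H (x, z) = H' (x, z + (M' - N)) := fun x z h1 h2 => by
    rw [hg x z h1, hf' x _ (by omega)]
  refine ⟨fun p => if p.2 ≤ N then H p else H' (p.1, p.2 + (M' - N)), ?_,
    ⟨M, N + (N' - M'), by omega, ?_, ?_⟩, ?_, ?_⟩
  · intro U hU
    refine subset (union (hH U hU) (hK U hU)) ?_
    rintro _ ⟨⟨⟨x, z⟩, ⟨y, w⟩⟩, hp, rfl⟩
    have hzw : |z - w| ≤ 1 := bornologous_snd U hU ⟨_, hp, rfl⟩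
    rw [abs_le] at hzw
    by_cases hle : z ≤ N ∧ w ≤ N
    · exact Or.inl ⟨_, hp, by simp [hle.1, hle.2]⟩
    · refine Or.inr ⟨_, hp, ?_⟩
      have h1 : ∀ (a : X) (t : ℤ), N ≤ t →
          (if t ≤ N then H (a, t) else H' (a, t + (M' - N))) = H' (a, t + (M' - N)) := by
        intro a t ht
        split_ifs with h2
        · exact key a t ht h2
        · rfl
      simp only [Prod.map_apply]
      rw [h1 x z (by omega), h1 y w (by omega)]
  · intro x z hz
    simp only
    rw [if_pos (by omega), hf x z hz]
  · intro x z hz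
    simp only
    rw [if_neg (by omega), hg' x _ (by omega)]
  · intro x hx z
    simp only
    split_ifs
    exacts [hA x hx _, hA' x hx _]
  · intro x hx z
    simp only
    split_ifs
    exacts [hB x hx _, hB' x hx _]

/-- Homotopy as an equivalence relation on maps of triples. -/
instance homotopySetoid (A B : Set X) (C D : Set Y) : Setoid (TripleMap A B C D) :=
  ⟨Homotopic, Homotopic.refl, Homotopic.symm, Homotopic.trans⟩

theorem Homotopic.comp_left (g : TripleMap C D E F) {f f' : TripleMap A B C D} :
    Homotopic f f' → Homotopic (g.comp f) (g.comp f') := by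
  rintro ⟨H, hH, ⟨M, N, hMN, hf, hg⟩, hA, hB⟩
  exact ⟨g ∘ H, g.bornologous.comp hH,
    ⟨M, N, hMN, fun x z hz => congrArg g (hf x z hz), fun x z hz => congrArg g (hg x z hz)⟩,
    fun x hx z => g.mapsTo_fst (hA x hx z), fun x hx z => g.mapsTo_snd (hB x hx z)⟩

theorem Homotopic.comp_right {f f' : TripleMap C D E F} (g : TripleMap A B C D) :
    Homotopic f f' → Homotopic (f.comp g) (f'.comp g) := by
  rintro ⟨H, hH, ⟨M, N, hMN, hf, hg⟩, hA, hB⟩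
  exact ⟨fun p => H (g p.1, p.2), hH.comp ((g.bornologous.comp bornologous_fst).prodMk
    bornologous_snd),
    ⟨M, N, hMN, fun x z hz => hf _ z hz, fun x z hz => hg _ z hz⟩,
    fun x hx z => hA _ (g.mapsTo_fst hx) z, fun x hx z => hB _ (g.mapsTo_snd hx) z⟩

end Triples

section Cubes

/-- The interval `I_m = {0, 1, …, m}`, a subspace of `ℤ`. -/
abbrev Interval (m : ℕ) : Type := Icc (0 : ℤ) m

/-- The cube `I_m^n`, with the product structure. -/
abbrev Cube (n m : ℕ) : Type := Fin n → Interval m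

/-- The boundary `∂I_m^n`. -/
def boundary (n m : ℕ) : Set (Cube n m) := {x | ∃ i, (x i : ℤ) = 0 ∨ (x i : ℤ) = m}

/-- The open box `J_m^{n-1} ⊆ ∂I_m^n`: if the last coordinate is `0`, then some other coordinate
is `0` or `m`. -/
def openBox (n m : ℕ) : Set (Cube n m) :=
  {x | x ∈ boundary n m ∧ ∀ l : Fin n, (l : ℕ) + 1 = n → (x l : ℤ) = 0 →
    ∃ i, i ≠ l ∧ ((x i : ℤ) = 0 ∨ (x i : ℤ) = m)}

/-- The retraction of `ℤ^n` onto `I_m^n`, coordinatewise `max(0, min(x_i, m))`. -/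
def clip {n : ℕ} (m : ℕ) (x : Fin n → ℤ) : Cube n m :=
  fun i => ⟨max 0 (min (x i) m), le_max_left _ _, max_le (by positivity) (min_le_right _ _)⟩

variable {n : ℕ}

theorem coe_clip (m : ℕ) (x : Fin n → ℤ) (i : Fin n) :
    (clip m x i : ℤ) = max 0 (min (x i) m) := rfl

theorem clip_coe {m : ℕ} (x : Cube n m) : clip m (fun i => (x i : ℤ)) = x := by
  funext i
  apply Subtype.ext
  have h1 := (x i).2.1
  have h2 := (x i).2.2
  rw [coe_clip]
  omega

theorem adj_cube {m : ℕ} {x y : Cube n m} :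
    SemiCoarseSpace.IsControlled {(x, y)} ↔ ∀ i, |(x i : ℤ) - y i| ≤ 1 := by
  constructor
  · intro h i
    have h1 := ((bornologous_val (Icc (0 : ℤ) m)).comp (bornologous_apply i)).adj h
    exact h1 rfl
  · intro h
    refine ⟨1, fun _ i => {(x i, y i)}, fun _ i => ⟨{((x i : ℤ), (y i : ℤ))}, ?_, ?_⟩, ?_⟩
    · rintro _ rfl
      exact h i
    · ext ⟨a, b⟩
      simp [Subtype.ext_iff]
    · rintro _ rfl
      simp

theorem openBox_cases {m : ℕ} {x : Cube n m} (hx : x ∈ openBox n m) :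
    (∃ i, (x i : ℤ) = m) ∨ ∃ i : Fin n, (i : ℕ) + 1 ≠ n ∧ (x i : ℤ) = 0 := by
  obtain ⟨⟨i, hi | hi⟩, h⟩ := hx
  · by_cases hn : (i : ℕ) + 1 = n
    · obtain ⟨k, hk, h0 | h0⟩ := h i hn hi
      · refine Or.inr ⟨k, fun hk' => hk (Fin.ext (by omega)), h0⟩
      · exact Or.inl ⟨k, h0⟩
    · exact Or.inr ⟨i, hn, hi⟩
  · exact Or.inl ⟨i, hi⟩

variable {X Y : Type*} [SemiCoarseSpace X] [SemiCoarseSpace Y]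

/-- Bornologous maps of triples `(I_m^n, ∂I_m^n, J_m^{n-1}) → (X, A, p)`. -/
abbrev CubeMap (n m : ℕ) (A : Set X) (p : A) : Type _ :=
  TripleMap (boundary n m) (openBox n m) A {(p : X)}

variable {A : Set X} {p : A}

/-- The retraction `φ` of the cube `I_{m'}^n` onto `I_m^n`, coordinatewise `min(x_i, m)`. -/
def retraction (n : ℕ) {m m' : ℕ} (hm : 0 < m) (h : m ≤ m') :
    TripleMap (boundary n m') (openBox n m') (boundary n m) (openBox n m) where
  toFun x := clip m fun i => (x i : ℤ)
  bornologous := by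
    refine bornologous_of_finite_range (toFinite _) fun x y hxy => ?_
    rw [adj_cube] at hxy ⊢
    intro i
    have := hxy i
    rw [abs_le] at *
    rw [coe_clip, coe_clip]
    omega
  mapsTo_fst := by
    rintro x ⟨i, hi⟩
    refine ⟨i, ?_⟩
    rw [coe_clip]
    omega
  mapsTo_snd := by
    rintro x ⟨⟨i, hi⟩, hx⟩
    refine ⟨⟨i, ?_⟩, ?_⟩
    · rw [coe_clip]
      omega
    · intro l hl h0
      have h1 := (x l).2.1
      rw [coe_clip] at h0
      obtain ⟨k, hk, hk'⟩ := hx l hl (by omega)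
      refine ⟨k, hk, ?_⟩
      rw [coe_clip]
      omega

/-- The constant map at the base point. -/
def CubeMap.const (n m : ℕ) (p : A) : CubeMap n m A p where
  toFun _ := p
  bornologous := bornologous_const _
  mapsTo_fst _ _ := p.2
  mapsTo_snd _ _ := rfl

/-- The set of homotopy classes `[(I_m^n, ∂I_m^n, J_m^{n-1}), (X, A, p)]`. -/
abbrev CubeClass (n m : ℕ) (A : Set X) (p : A) : Type _ :=
  Quotient (homotopySetoid (boundary n m) (openBox n m) A {(p : X)})

/-- The class of the constant map. -/
instance (m : ℕ) : One (CubeClass n m A p) := ⟨Quotient.mk _ (CubeMap.const n m p)⟩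

/-- The map `[f] ↦ [f ∘ φ]` of pointed sets from classes on `I_m^n` to classes on `I_{m'}^n`. -/
def extend (n : ℕ) (A : Set X) (p : A) (m m' : ℕ+) (h : m ≤ m') :
    OneHom (CubeClass n m A p) (CubeClass n m' A p) where
  toFun := Quotient.map (fun f => f.comp (retraction n m.pos (PNat.coe_le_coe _ _ |>.2 h)))
    fun _ _ => Homotopic.comp_right _
  map_one' := rfl

instance (n : ℕ) (A : Set X) (p : A) :
    DirectedSystem (fun m : ℕ+ => CubeClass n m A p) (extend n A p · · ·) where
  map_self m x := by
    induction x using Quotient.inductionOn with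
    | h f =>
      refine congrArg (Quotient.mk _) (TripleMap.ext fun x => congrArg f ?_)
      exact clip_coe x
  map_map m m' m'' h h' x := by
    induction x using Quotient.inductionOn with
    | h f =>
      refine congrArg (Quotient.mk _) (TripleMap.ext fun x => congrArg f ?_)
      have := PNat.coe_le_coe _ _ |>.2 h
      funext i
      apply Subtype.ext
      change (clip _ (fun i => (clip _ (fun i => (x i : ℤ)) i : ℤ)) i : ℤ) = clip _ _ i
      rw [coe_clip, coe_clip, coe_clip]
      omega

/-- The set `π_n(X, A, p)`, `n ≥ 1`: the direct limit of the sets of homotopy classes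
`[(I_m^n, ∂I_m^n, J_m^{n-1}), (X, A, p)]` over the positive integers `m`. -/
def RelPi (n : ℕ) (A : Set X) (p : A) : Type _ :=
  DirectLimit (fun m : ℕ+ => CubeClass n m A p) (extend n A p)

/-- The element `⟨f⟩` of `π_n(X, A, p)` represented by `f`. -/
def RelPi.mk {m : ℕ} (hm : 0 < m) (f : CubeMap n m A p) : RelPi n A p :=
  Quotient.mk _ (⟨⟨m, hm⟩, Quotient.mk _ f⟩ : Σ m : ℕ+, CubeClass n m A p)

theorem RelPi.mk_comp_retraction {m m' : ℕ} (hm : 0 < m) (h : m ≤ m') (f : CubeMap n m A p) :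
    RelPi.mk (hm.trans_le h) (f.comp (retraction n hm h)) = RelPi.mk hm f :=
  DirectLimit.mk_apply (F := fun m : ℕ+ => CubeClass n m A p) (f := extend n A p) ⟨m, hm⟩
    ⟨m', hm.trans_le h⟩ (Quotient.mk _ f : CubeClass n m A p) h

/-- The base point of `π_n(X, A, p)`, the class of the constant map. -/
instance : One (RelPi n A p) := ⟨RelPi.mk one_pos (CubeMap.const n 1 p)⟩

theorem RelPi.sound {m : ℕ} (hm : 0 < m) {f g : CubeMap n m A p} (h : Homotopic f g) :
    RelPi.mk hm f = RelPi.mk hm g :=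
  congrArg (fun c => Quotient.mk _ (⟨⟨m, hm⟩, c⟩ : Σ m : ℕ+, CubeClass n m A p))
    (Quotient.sound h)

/-- The map `⟨f⟩ ↦ ⟨g ∘ f⟩` induced by a bornologous map `g` of pointed pairs. -/
def RelPi.map (n : ℕ) {B : Set Y} {q : B} (g : TripleMap A {(p : X)} B {(q : Y)}) :
    RelPi n A p → RelPi n B q :=
  DirectLimit.lift _
    (fun m => Quotient.lift (fun f => RelPi.mk m.pos (g.comp f)) fun _ _ h =>
      RelPi.sound m.pos (Homotopic.comp_left g h))
    (by
      intro m m' h x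
      induction x using Quotient.inductionOn with
      | h f => exact (RelPi.mk_comp_retraction m.pos h (g.comp f)).symm)

theorem RelPi.map_mk {B : Set Y} {q : B} (g : TripleMap A {(p : X)} B {(q : Y)}) {m : ℕ}
    (hm : 0 < m) (f : CubeMap n m A p) :
    RelPi.map n g (RelPi.mk hm f) = RelPi.mk hm (g.comp f) := rfl

theorem RelPi.exists_rep (a : RelPi n A p) :
    ∃ (m : ℕ) (hm : 0 < m) (f : CubeMap n m A p), a = RelPi.mk hm f := by
  obtain ⟨m, c, rfl⟩ := DirectLimit.exists_eq_mk _ a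
  obtain ⟨f, rfl⟩ := Quotient.exists_rep c
  exact ⟨m, m.pos, f, rfl⟩

end Cubes

section Groups

variable {n : ℕ} {X Y : Type*} [SemiCoarseSpace X] [SemiCoarseSpace Y] {A : Set X} {p : A}

/-- The extension `f ∘ clip m` of a map on `I_m^n` to all of `ℤ^n`. -/
def CubeMap.spread {m : ℕ} (f : CubeMap n m A p) (x : Fin n → ℤ) : X := f (clip m x)

namespace CubeMap

variable {m m' k : ℕ}

theorem spread_coe (f : CubeMap n m A p) (x : Cube n m) :
    f.spread (fun i => (x i : ℤ)) = f x := congrArg f (clip_coe x)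

theorem spread_congr (f : CubeMap n m A p) {x y : Fin n → ℤ}
    (h : ∀ i, max 0 (min (x i) m) = max 0 (min (y i) m)) : f.spread x = f.spread y :=
  congrArg f (funext fun i => Subtype.ext (h i))

theorem spread_adj (f : CubeMap n m A p) {x y : Fin n → ℤ} (h : ∀ i, |x i - y i| ≤ 1) :
    SemiCoarseSpace.IsControlled {(f.spread x, f.spread y)} := by
  refine f.bornologous.adj (adj_cube.2 fun i => ?_)
  have := h i
  rw [abs_le] at *
  rw [coe_clip, coe_clip]
  omega

theorem spread_mem (f : CubeMap n m A p) {x : Fin n → ℤ} (i : Fin n) (h : x i ≤ 0 ∨ m ≤ x i) :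
    f.spread x ∈ A := by
  refine f.mapsTo_fst ⟨i, ?_⟩
  rw [coe_clip]
  omega

theorem spread_eq (hm : 0 < m) (f : CubeMap n m A p) {x : Fin n → ℤ} (i : Fin n)
    (h : m ≤ x i ∨ x i ≤ 0 ∧ (i : ℕ) + 1 ≠ n) : f.spread x = p := by
  refine f.mapsTo_snd ⟨⟨i, ?_⟩, ?_⟩
  · rw [coe_clip]
    omega
  · intro l hl h0
    refine ⟨i, ?_, ?_⟩
    · rintro rfl
      rw [coe_clip] at h0
      omega
    · rw [coe_clip]
      omega

theorem spread_comp_retraction (hm : 0 < m) (h : m ≤ m') (f : CubeMap n m A p) :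
    spread (f.comp (retraction n hm h)) = f.spread := by
  funext x
  refine congrArg f (funext fun i => Subtype.ext ?_)
  change (clip m (fun i => (clip m' x i : ℤ)) i : ℤ) = _
  rw [coe_clip, coe_clip, coe_clip]
  omega

/-- A criterion for two maps on a cube to be homotopic, given a family of maps `H · z`
that moves from one to the other. -/
theorem homotopic_of {u v : CubeMap n m A p} (H : Cube n m → ℤ → X) (T : ℕ)
    (h0 : ∀ x, ∀ z ≤ 0, H x z = u x) (hT : ∀ x, ∀ z : ℤ, T ≤ z → H x z = v x)
    (hadj : ∀ x y z w, (∀ i, |(x i : ℤ) - y i| ≤ 1) → |z - w| ≤ 1 →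
      SemiCoarseSpace.IsControlled {(H x z, H y w)})
    (hA : ∀ x ∈ boundary n m, ∀ z, H x z ∈ A) (hp : ∀ x ∈ openBox n m, ∀ z, H x z = p) :
    Homotopic u v := by
  refine ⟨fun q => H q.1 q.2, bornologous_of_finite_range ?_ ?_,
    ⟨0, T + 1, by positivity, h0, fun x z hz => hT x z (by omega)⟩, hA, hp⟩
  · refine ((Set.toFinite (Set.univ : Set (Cube n m))).prod
      (Set.finite_Icc (0 : ℤ) T)).image (fun q => H q.1 q.2) |>.subset ?_
    rintro _ ⟨⟨x, z⟩, rfl⟩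
    by_cases hz : z ≤ 0
    · exact ⟨(x, 0), ⟨trivial, le_rfl, by positivity⟩, by simp [h0 x z hz, h0 x 0 le_rfl]⟩
    · by_cases hz' : (T : ℤ) ≤ z
      · exact ⟨(x, T), ⟨trivial, by positivity, le_rfl⟩, by simp [hT x z hz', hT x T le_rfl]⟩
      · exact ⟨(x, z), ⟨trivial, by omega, by omega⟩, rfl⟩
  · rintro ⟨x, z⟩ ⟨y, w⟩ h
    refine hadj x y z w (adj_cube.1 ?_) (bornologous_snd.adj h rfl)
    exact bornologous_fst.adj h

variable [NeZero n]

theorem spread_eq_zero (h : 2 ≤ n ∨ A ⊆ {(p : X)}) (hm : 0 < m) (f : CubeMap n m A p)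
    {x : Fin n → ℤ} (hx : x 0 ≤ 0 ∨ m ≤ x 0) : f.spread x = p := by
  rcases h with h | h
  · exact f.spread_eq hm 0 (by simp; omega)
  · exact h (f.spread_mem 0 hx)

/-- Two reparametrizations of the first coordinate give homotopic maps. -/
theorem homotopic_reparam (h : 2 ≤ n ∨ A ⊆ {(p : X)}) (hm : 0 < m) (hmk : m ≤ k)
    (f : CubeMap n m A p) (u v : CubeMap n k A p) (σ τ : ℤ → ℤ)
    (hσ : ∀ a b, |a - b| ≤ 1 → |σ a - σ b| ≤ 1) (hτ : ∀ a b, |a - b| ≤ 1 → |τ a - τ b| ≤ 1)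
    (hle : ∀ a, σ a ≤ τ a)
    (hu : ∀ x : Cube n k, u x = f.spread (Function.update (fun i => (x i : ℤ)) 0 (σ (x 0))))
    (hv : ∀ x : Cube n k, v x = f.spread (Function.update (fun i => (x i : ℤ)) 0 (τ (x 0))))
    (h0 : τ 0 ≤ 0 ∨ m ≤ σ 0) (hk : τ k ≤ 0 ∨ m ≤ σ k) : Homotopic u v := by
  have upd : ∀ (x : Cube n k) (s : ℤ) (i : Fin n), i ≠ 0 →
      Function.update (fun i => (x i : ℤ)) 0 s i = x i := fun x s i hi => by simp [hi]
  have mid : ∀ (a z : ℤ), (τ a ≤ 0 ∨ m ≤ σ a) →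
      max (σ a) (min (τ a) z) ≤ 0 ∨ m ≤ max (σ a) (min (τ a) z) := by
    intro a z ha
    have := hle a
    omega
  have side : ∀ (x : Cube n k) (z : ℤ), ((x 0 : ℤ) = 0 ∨ (x 0 : ℤ) = k) →
      f.spread (Function.update (fun i => (x i : ℤ)) 0 (max (σ (x 0)) (min (τ (x 0)) z))) = p := by
    intro x z hx
    refine spread_eq_zero h hm f ?_
    rw [Function.update_self]
    rcases hx with hx | hx <;> rw [hx]
    exacts [mid _ _ h0, mid _ _ hk]
  refine homotopic_of (fun x z => f.spread (Function.update (fun i => (x i : ℤ)) 0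
    (max (σ (x 0)) (min (τ (x 0)) z)))) m ?_ ?_ ?_ ?_ ?_
  · intro x z hz
    rw [hu]
    refine f.spread_congr fun i => ?_
    by_cases hi : i = 0
    · subst hi
      rw [Function.update_self, Function.update_self]
      omega
    · rw [upd _ _ _ hi, upd _ _ _ hi]
  · intro x z hz
    rw [hv]
    refine f.spread_congr fun i => ?_
    have := hle (x 0)
    by_cases hi : i = 0
    · subst hi
      rw [Function.update_self, Function.update_self]
      omega
    · rw [upd _ _ _ hi, upd _ _ _ hi]
  · intro x y z w hxy hzw
    refine f.spread_adj fun i => ?_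
    by_cases hi : i = 0
    · subst hi
      rw [Function.update_self, Function.update_self]
      have h1 := hσ _ _ (hxy 0)
      have h2 := hτ _ _ (hxy 0)
      rw [abs_le] at *
      omega
    · rw [upd _ _ _ hi, upd _ _ _ hi]
      exact hxy i
  · rintro x ⟨i, hx⟩ z
    by_cases hi : i = 0
    · subst hi
      simp only [side x z hx]
      exact p.2
    · refine f.spread_mem i ?_
      rw [upd _ _ _ hi]
      omega
  · intro x hx z
    rcases openBox_cases hx with ⟨i, hi⟩ | ⟨i, hin, hi⟩
    · by_cases hi0 : i = 0
      · subst hi0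
        exact side x z (Or.inr hi)
      · refine f.spread_eq hm i (Or.inl ?_)
        rw [upd _ _ _ hi0]
        omega
    · by_cases hi0 : i = 0
      · subst hi0
        exact side x z (Or.inl hi)
      · refine f.spread_eq hm i (Or.inr ⟨?_, hin⟩)
        rw [upd _ _ _ hi0]
        omega

/-- The point `x - c e_1`. -/
def shift (c : ℤ) (x : Fin n → ℤ) : Fin n → ℤ := fun i => x i - if i = 0 then c else 0

theorem shift_zero (c : ℤ) (x : Fin n → ℤ) : shift c x 0 = x 0 - c := by simp [shift]

theorem shift_ne (c : ℤ) (x : Fin n → ℤ) {i : Fin n} (hi : i ≠ 0) : shift c x i = x i := by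
  simp [shift, hi]

theorem shift_adj (c : ℤ) {x y : Fin n → ℤ} (h : ∀ i, |x i - y i| ≤ 1) (i : Fin n) :
    |shift c x i - shift c y i| ≤ 1 := by
  simpa [shift] using h i

/-- Two maps that are constant on the faces orthogonal to the first axis can be joined. -/
theorem join_adj {F G : (Fin n → ℤ) → ℤ → X}
    (hF : ∀ x y z w, (∀ i, |x i - y i| ≤ 1) → |z - w| ≤ 1 →
      SemiCoarseSpace.IsControlled {(F x z, F y w)})
    (hG : ∀ x y z w, (∀ i, |x i - y i| ≤ 1) → |z - w| ≤ 1 →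
      SemiCoarseSpace.IsControlled {(G x z, G y w)})
    (hFm : ∀ x z, x 0 = (m : ℤ) → F x z = p) (hGm : ∀ x z, x 0 = 0 → G x z = p)
    (x y : Fin n → ℤ) (z w : ℤ) (hxy : ∀ i, |x i - y i| ≤ 1) (hzw : |z - w| ≤ 1) :
    SemiCoarseSpace.IsControlled
      {((if x 0 ≤ m then F x z else G (shift m x) z),
        (if y 0 ≤ m then F y w else G (shift m y) w))} := by
  have h0 := hxy 0
  rw [abs_le] at h0
  have h' := hG _ _ z w (shift_adj m hxy) hzw
  split_ifs with h1 h2 h2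
  · exact hF x y z w hxy hzw
  · rw [hFm x z (by omega), ← hGm (shift m x) z (by rw [shift_zero]; omega)]
    exact h'
  · rw [hFm y w (by omega), ← hGm (shift m y) w (by rw [shift_zero]; omega)]
    exact h'
  · exact h'

/-- The product `f ⋆ g`: it is `f(φ(α))` where `α_1 ≤ m` and `g(φ(α - m e_1))` where `m < α_1`.
It is a map of triples if `n ≥ 2` or `A = {p}`. -/
def star (h : 2 ≤ n ∨ A ⊆ {(p : X)}) (hm : 0 < m) (hm' : 0 < m') (f : CubeMap n m A p)
    (g : CubeMap n m' A p) : CubeMap n (m + m') A p where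
  toFun α := if (α 0 : ℤ) ≤ m then f (clip m fun i => (α i : ℤ))
    else g (clip m' (shift m fun i => (α i : ℤ)))
  bornologous := by
    refine bornologous_of_finite_range (Set.toFinite _) fun x y hxy => ?_
    exact join_adj (F := fun x _ => f.spread x) (G := fun x _ => g.spread x)
      (fun x y _ _ hxy _ => f.spread_adj hxy) (fun x y _ _ hxy _ => g.spread_adj hxy)
      (fun x _ hx => spread_eq_zero h hm f (by omega))
      (fun x _ hx => spread_eq_zero h hm' g (by omega)) _ _ 0 0 (adj_cube.1 hxy) (by simp)
  mapsTo_fst := by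
    rintro x ⟨i, hx⟩
    dsimp only
    split_ifs with h0
    · by_cases hi : i = 0
      · subst hi
        exact f.spread_mem 0 (by omega)
      · exact f.spread_mem i (by omega)
    · by_cases hi : i = 0
      · subst hi
        exact g.spread_mem 0 (by rw [shift_zero]; omega)
      · exact g.spread_mem i (by rw [shift_ne _ _ hi]; omega)
  mapsTo_snd := by
    intro x hx
    have hx' : ((x 0 : ℤ) = 0 ∨ (x 0 : ℤ) = m + m') ∨ ∃ i : Fin n, i ≠ 0 ∧
        ((x i : ℤ) = m + m' ∨ (x i : ℤ) = 0 ∧ (i : ℕ) + 1 ≠ n) := by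
      rcases openBox_cases hx with ⟨i, hi⟩ | ⟨i, hin, hi⟩ <;> by_cases h0 : i = 0
      · subst h0; left; right; push_cast at hi; exact hi
      · right; exact ⟨i, h0, Or.inl (by push_cast at hi; exact hi)⟩
      · subst h0; left; left; exact hi
      · right; exact ⟨i, h0, Or.inr ⟨hi, hin⟩⟩
    dsimp only
    rcases hx' with hx' | ⟨i, hi, hx'⟩ <;> split_ifs with h0
    · exact spread_eq_zero h hm f (by omega)
    · exact spread_eq_zero h hm' g (by rw [shift_zero]; omega)
    · exact spread_eq hm f i (by omega)
    · exact spread_eq hm' g i (by rw [shift_ne _ _ hi]; omega)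

theorem spread_star (h : 2 ≤ n ∨ A ⊆ {(p : X)}) (hm : 0 < m) (hm' : 0 < m')
    (f : CubeMap n m A p) (g : CubeMap n m' A p) (x : Fin n → ℤ) :
    (star h hm hm' f g).spread x =
      if x 0 ≤ m then f.spread x else g.spread (shift m x) := by
  change (if (clip (m + m') x 0 : ℤ) ≤ m then f.spread (fun i => (clip (m + m') x i : ℤ))
    else g.spread (shift m fun i => (clip (m + m') x i : ℤ))) = _
  rw [coe_clip]
  have e : (max 0 (min (x 0) ((m + m' : ℕ) : ℤ)) ≤ m) ↔ x 0 ≤ m := by omega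
  rw [if_congr e rfl rfl]
  split_ifs with h0
  · refine f.spread_congr fun i => ?_
    rw [coe_clip]
    omega
  · refine g.spread_congr fun i => ?_
    by_cases hi : i = 0
    · subst hi
      rw [shift_zero, shift_zero, coe_clip]
      omega
    · rw [shift_ne _ _ hi, shift_ne _ _ hi, coe_clip]
      omega

theorem star_homotopic (h : 2 ≤ n ∨ A ⊆ {(p : X)}) (hm : 0 < m) (hm' : 0 < m')
    {f f' : CubeMap n m A p} {g g' : CubeMap n m' A p} (hf : Homotopic f f')
    (hg : Homotopic g g') : Homotopic (star h hm hm' f g) (star h hm hm' f' g') := by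
  obtain ⟨H, hH, ⟨M, N, hMN, h0, h1⟩, hA, hp⟩ := hf
  obtain ⟨K, hK, ⟨M', N', hMN', k0, k1⟩, kA, kp⟩ := hg
  let Hm (z : ℤ) : CubeMap n m A p := ⟨fun x => H (x, z),
    hH.comp (bornologous_id.prodMk (bornologous_const z)), fun x hx => hA x hx z,
    fun x hx => hp x hx z⟩
  let Km (z : ℤ) : CubeMap n m' A p := ⟨fun x => K (x, z),
    hK.comp (bornologous_id.prodMk (bornologous_const z)), fun x hx => kA x hx z,
    fun x hx => kp x hx z⟩
  have adjH : ∀ (x y : Fin n → ℤ) (z w : ℤ), (∀ i, |x i - y i| ≤ 1) → |z - w| ≤ 1 →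
      SemiCoarseSpace.IsControlled {((Hm z).spread x, (Hm w).spread y)} := by
    intro x y z w hxy hzw
    refine hH.adj (x := (clip m x, z)) (y := (clip m y, w)) ?_
    have := (Bornologous.prodMk (X := Cube n m) (Y := ℤ) bornologous_fst bornologous_snd)
    refine ⟨1, fun _ => {(clip m x, clip m y)}, fun _ => {(z, w)}, fun _ => ?_, fun _ => ?_, ?_⟩
    · refine adj_cube.2 fun i => ?_
      have := hxy i
      rw [abs_le] at *
      rw [coe_clip, coe_clip]
      omega
    · rintro _ rfl
      exact hzw
    · rintro _ rfl
      simp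
  have adjK : ∀ (x y : Fin n → ℤ) (z w : ℤ), (∀ i, |x i - y i| ≤ 1) → |z - w| ≤ 1 →
      SemiCoarseSpace.IsControlled {((Km z).spread x, (Km w).spread y)} := by
    intro x y z w hxy hzw
    refine hK.adj (x := (clip m' x, z)) (y := (clip m' y, w)) ?_
    refine ⟨1, fun _ => {(clip m' x, clip m' y)}, fun _ => {(z, w)}, fun _ => ?_, fun _ => ?_, ?_⟩
    · refine adj_cube.2 fun i => ?_
      have := hxy i
      rw [abs_le] at *
      rw [coe_clip, coe_clip]
      omega
    · rintro _ rfl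
      exact hzw
    · rintro _ rfl
      simp
  refine ⟨fun q => star h hm hm' (Hm q.2) (Km q.2) q.1, bornologous_of_finite_range ?_ ?_,
    ⟨min M M', max N N', by omega, ?_, ?_⟩, fun x hx z => (star h hm hm' (Hm z) (Km z)).mapsTo_fst hx,
    fun x hx z => (star h hm hm' (Hm z) (Km z)).mapsTo_snd hx⟩
  · refine ((Set.toFinite (Set.univ : Set (Cube n (m + m')))).prod
      (Set.finite_Icc (min M M') (max N N'))).image
        (fun q => star h hm hm' (Hm q.2) (Km q.2) q.1) |>.subset ?_
    rintro _ ⟨⟨x, z⟩, rfl⟩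
    refine ⟨(x, max (min M M') (min z (max N N'))), ⟨trivial, le_max_left _ _, by simp; omega⟩, ?_⟩
    have e1 : Hm (max (min M M') (min z (max N N'))) = Hm z := by
      refine TripleMap.ext fun y => ?_
      change H (y, _) = H (y, _)
      by_cases c1 : z ≤ min M M'
      · rw [h0 y z (by omega), h0 y _ (by omega)]
      by_cases c2 : max N N' ≤ z
      · rw [h1 y z (by omega), h1 y _ (by omega)]
      congr 2
      omega
    have e2 : Km (max (min M M') (min z (max N N'))) = Km z := by
      refine TripleMap.ext fun y => ?_
      change K (y, _) = K (y, _)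
      by_cases c1 : z ≤ min M M'
      · rw [k0 y z (by omega), k0 y _ (by omega)]
      by_cases c2 : max N N' ≤ z
      · rw [k1 y z (by omega), k1 y _ (by omega)]
      congr 2
      omega
    simp only [e1, e2]
  · rintro ⟨x, z⟩ ⟨y, w⟩ hxy
    exact join_adj adjH adjK (fun x z hx => spread_eq_zero h hm (Hm z) (by omega))
      (fun x z hx => spread_eq_zero h hm' (Km z) (by omega)) _ _ z w
      (adj_cube.1 (bornologous_fst.adj hxy)) (bornologous_snd.adj hxy rfl)
  · intro x z hz
    have e1 : Hm z = f := TripleMap.ext fun y => h0 y z (by omega)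
    have e2 : Km z = g := TripleMap.ext fun y => k0 y z (by omega)
    simp only [e1, e2]
  · intro x z hz
    have e1 : Hm z = f' := TripleMap.ext fun y => h1 y z (by omega)
    have e2 : Km z = g' := TripleMap.ext fun y => k1 y z (by omega)
    simp only [e1, e2]

/-- The reflection of `I_m^n` in the first coordinate. -/
def reflect (x : Cube n m) : Cube n m :=
  fun i => if i = 0 then ⟨m - x i, by have := (x i).2.2; omega, by have := (x i).2.1; omega⟩
    else x i

theorem reflect_zero (x : Cube n m) : (reflect x 0 : ℤ) = m - x 0 := by simp [reflect]

theorem reflect_ne (x : Cube n m) {i : Fin n} (hi : i ≠ 0) : reflect x i = x i := by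
  simp [reflect, hi]

/-- The reflection as a map of triples; the image of `J` lies in `J` or in the faces orthogonal
to the first axis. -/
def reverse (h : 2 ≤ n ∨ A ⊆ {(p : X)}) (hm : 0 < m) (f : CubeMap n m A p) :
    CubeMap n m A p where
  toFun x := f (reflect x)
  bornologous := by
    refine bornologous_of_finite_range (Set.toFinite _) fun x y hxy => ?_
    refine f.bornologous.adj (adj_cube.2 fun i => ?_)
    have := adj_cube.1 hxy i
    by_cases hi : i = 0
    · subst hi
      rw [abs_le] at *
      rw [reflect_zero, reflect_zero]
      omega
    · rwa [reflect_ne _ hi, reflect_ne _ hi]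
  mapsTo_fst := by
    rintro x ⟨i, hx⟩
    refine f.mapsTo_fst ⟨i, ?_⟩
    by_cases hi : i = 0
    · subst hi
      rw [reflect_zero]
      omega
    · rwa [reflect_ne _ hi]
  mapsTo_snd := by
    intro x hx
    change f (reflect x) = p
    rw [← spread_coe]
    rcases openBox_cases hx with ⟨i, hi⟩ | ⟨i, hin, hi⟩ <;> by_cases h0 : i = 0
    · subst h0
      exact spread_eq_zero h hm f (by rw [reflect_zero]; omega)
    · exact spread_eq hm f i (by rw [reflect_ne _ h0]; omega)
    · subst h0
      exact spread_eq_zero h hm f (by rw [reflect_zero]; omega)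
    · exact spread_eq hm f i (by rw [reflect_ne _ h0]; omega)

theorem reverse_apply (h : 2 ≤ n ∨ A ⊆ {(p : X)}) (hm : 0 < m) (f : CubeMap n m A p)
    (x : Cube n m) : reverse h hm f x =
      f.spread (Function.update (fun i => (x i : ℤ)) 0 (m - x 0)) := by
  change f (reflect x) = _
  rw [← spread_coe]
  refine f.spread_congr fun i => ?_
  by_cases hi : i = 0
  · subst hi
    rw [reflect_zero, Function.update_self]
  · rw [reflect_ne _ hi, Function.update_of_ne hi]

theorem reverse_homotopic (h : 2 ≤ n ∨ A ⊆ {(p : X)}) (hm : 0 < m) {f f' : CubeMap n m A p} :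
    Homotopic f f' → Homotopic (reverse h hm f) (reverse h hm f') := by
  rintro ⟨H, hH, ⟨M, N, hMN, h0, h1⟩, hA, hp⟩
  have hr : Bornologous (reflect : Cube n m → Cube n m) := by
    refine bornologous_of_finite_range (Set.toFinite _) fun x y hxy => ?_
    refine adj_cube.2 fun i => ?_
    have := adj_cube.1 hxy i
    by_cases hi : i = 0
    · subst hi
      rw [abs_le] at *
      rw [reflect_zero, reflect_zero]
      omega
    · rwa [reflect_ne _ hi, reflect_ne _ hi]
  let Hm (z : ℤ) : CubeMap n m A p := ⟨fun x => H (x, z),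
    hH.comp (bornologous_id.prodMk (bornologous_const z)), fun x hx => hA x hx z,
    fun x hx => hp x hx z⟩
  exact ⟨fun q => H (reflect q.1, q.2),
    hH.comp ((hr.comp bornologous_fst).prodMk bornologous_snd),
    ⟨M, N, hMN, fun x z hz => h0 _ z hz, fun x z hz => h1 _ z hz⟩,
    fun x hx z => (reverse h hm (Hm z)).mapsTo_fst hx,
    fun x hx z => (reverse h hm (Hm z)).mapsTo_snd hx⟩

end CubeMap

namespace RelPi

open CubeMap

theorem mk_eq_of_spread {m m' : ℕ} {hm : 0 < m} {hm' : 0 < m'} {f : CubeMap n m A p}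
    {g : CubeMap n m' A p} (h : f.spread = g.spread) : mk hm f = mk hm' g := by
  rw [← mk_comp_retraction hm (le_max_left m m') f,
    ← mk_comp_retraction hm' (le_max_right m m') g]
  congr 1
  refine TripleMap.ext fun x => ?_
  rw [← spread_coe, ← spread_coe, spread_comp_retraction, spread_comp_retraction, h]

theorem one_eq {m : ℕ} (hm : 0 < m) : (1 : RelPi n A p) = mk hm (CubeMap.const n m p) :=
  mk_eq_of_spread rfl

variable [NeZero n]

/-- Maps obtained from one map by reparametrizing the first coordinate represent the same class. -/
theorem mk_eq_of_reparam (h : 2 ≤ n ∨ A ⊆ {(p : X)}) {m k : ℕ} (hm : 0 < m)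
    (hk0 : 0 < k) (hmk : m ≤ k)
    (f : CubeMap n m A p) (u v : CubeMap n k A p) (σ τ : ℤ → ℤ)
    (hσ : ∀ a b, |a - b| ≤ 1 → |σ a - σ b| ≤ 1) (hτ : ∀ a b, |a - b| ≤ 1 → |τ a - τ b| ≤ 1)
    (hle : ∀ a, σ a ≤ τ a)
    (hu : ∀ x : Cube n k, u x = f.spread (Function.update (fun i => (x i : ℤ)) 0 (σ (x 0))))
    (hv : ∀ x : Cube n k, v x = f.spread (Function.update (fun i => (x i : ℤ)) 0 (τ (x 0))))
    (h0 : τ 0 ≤ 0 ∨ m ≤ σ 0) (hk : τ k ≤ 0 ∨ m ≤ σ k) :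
    mk hk0 u = mk hk0 v :=
  sound hk0 (homotopic_reparam h hm hmk f u v σ τ hσ hτ hle hu hv h0 hk)

theorem mk_star_comp_retraction (h : 2 ≤ n ∨ A ⊆ {(p : X)}) {m m' k k' : ℕ} (hm : 0 < m)
    (hm' : 0 < m') (hk : m ≤ k) (hk' : m' ≤ k') (f : CubeMap n m A p) (g : CubeMap n m' A p) :
    mk (Nat.add_pos_left (hm.trans_le hk) k') (star h (hm.trans_le hk) (hm'.trans_le hk')
      (f.comp (retraction n hm hk)) (g.comp (retraction n hm' hk'))) =
    mk (Nat.add_pos_left hm m') (star h hm hm' f g) := by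
  have hle : m + m' ≤ k + k' := add_le_add hk hk'
  rw [← mk_comp_retraction (Nat.add_pos_left hm m') hle (star h hm hm' f g)]
  refine mk_eq_of_reparam h (Nat.add_pos_left hm m') _ hle (star h hm hm' f g) _ _
    (fun a => max (min a m) (a - (k - m))) id ?_ ?_ ?_ ?_ ?_ ?_ ?_
  · intro a b hab
    rw [abs_le] at *
    omega
  · exact fun a b hab => hab
  · intro a
    simp only [id]
    omega
  · intro x
    rw [← spread_coe (star h _ _ _ _), spread_star, spread_star, spread_comp_retraction,
      spread_comp_retraction, Function.update_self]
    have e : max (min (x 0 : ℤ) m) (x 0 - (k - m)) ≤ m ↔ (x 0 : ℤ) ≤ k := by omega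
    rw [if_congr e rfl rfl]
    split_ifs with h0
    · refine f.spread_congr fun i => ?_
      by_cases hi : i = 0
      · subst hi
        rw [Function.update_self]
        omega
      · rw [Function.update_of_ne hi]
    · refine g.spread_congr fun i => ?_
      by_cases hi : i = 0
      · subst hi
        rw [shift_zero, shift_zero, Function.update_self]
        omega
      · rw [shift_ne _ _ hi, shift_ne _ _ hi, Function.update_of_ne hi]
  · intro x
    rw [← spread_coe (TripleMap.comp _ _), spread_comp_retraction]
    congr 1
    funext i
    by_cases hi : i = 0
    · subst hi
      simp
    · simp [hi]
  · exact Or.inl le_rfl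
  · refine Or.inr ?_
    push_cast
    omega

/-- The product `⟨f⟩ ⋆ ⟨g⟩ = ⟨f ⋆ g⟩`, for `n ≥ 2` or `A = {p}`. -/
noncomputable def mul (h : 2 ≤ n ∨ A ⊆ {(p : X)}) : RelPi n A p → RelPi n A p → RelPi n A p :=
  DirectLimit.lift₂ _ _
    (fun m => Quotient.lift₂
      (fun f g => mk (Nat.add_pos_left m.pos m) (star h m.pos m.pos f g))
      fun _ _ _ _ hf hg => sound _ (star_homotopic h m.pos m.pos hf hg))
    (by
      intro m k hmk x y
      induction x, y using Quotient.inductionOn₂ with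
      | h f g => exact (mk_star_comp_retraction h m.pos m.pos hmk hmk f g).symm)

theorem mul_mk (h : 2 ≤ n ∨ A ⊆ {(p : X)}) {m m' : ℕ} (hm : 0 < m) (hm' : 0 < m')
    (f : CubeMap n m A p) (g : CubeMap n m' A p) :
    mul h (mk hm f) (mk hm' g) = mk (Nat.add_pos_left hm m') (star h hm hm' f g) := by
  rw [← mk_star_comp_retraction h hm hm' (le_max_left m m') (le_max_right m m'),
    ← mk_comp_retraction hm (le_max_left m m') f, ← mk_comp_retraction hm' (le_max_right m m') g]
  exact DirectLimit.lift₂_def (F₁ := fun m : ℕ+ => CubeClass n m A p)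
    (F₂ := fun m : ℕ+ => CubeClass n m A p) (extend n A p) (extend n A p) _ _
    ⟨max m m', hm.trans_le (le_max_left m m')⟩ (Quotient.mk _ _) (Quotient.mk _ _)

theorem mk_reverse_comp_retraction (h : 2 ≤ n ∨ A ⊆ {(p : X)}) {m k : ℕ} (hm : 0 < m)
    (hmk : m ≤ k) (f : CubeMap n m A p) :
    mk hm (reverse h hm f) =
      mk (hm.trans_le hmk) (reverse h (hm.trans_le hmk) (f.comp (retraction n hm hmk))) := by
  rw [← mk_comp_retraction hm hmk]
  refine mk_eq_of_reparam h hm _ hmk f _ _ (fun a => m - a) (fun a => k - a) ?_ ?_ ?_ ?_ ?_ ?_ ?_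
  · intro a b hab
    rw [abs_le] at *
    omega
  · intro a b hab
    rw [abs_le] at *
    omega
  · intro a
    omega
  · intro x
    rw [← spread_coe (TripleMap.comp _ _), spread_comp_retraction]
    change reverse h hm f _ = _
    rw [reverse_apply]
    refine f.spread_congr fun i => ?_
    by_cases hi : i = 0
    · subst hi
      rw [Function.update_self, Function.update_self, coe_clip]
      have := (x 0).2.1
      omega
    · rw [Function.update_of_ne hi, Function.update_of_ne hi, coe_clip]
      omega
  · intro x
    rw [reverse_apply, spread_comp_retraction]
  · right
    simp
  · left
    simp

/-- The inverse of `⟨f⟩`, represented by the reflection of `f` in the first coordinate. -/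
def inv (h : 2 ≤ n ∨ A ⊆ {(p : X)}) : RelPi n A p → RelPi n A p :=
  DirectLimit.lift _
    (fun m => Quotient.lift (fun f => mk m.pos (reverse h m.pos f))
      fun _ _ hf => sound _ (reverse_homotopic h m.pos hf))
    (by
      intro m k hmk x
      induction x using Quotient.inductionOn with
      | h f => exact mk_reverse_comp_retraction h m.pos hmk f)

theorem inv_mk (h : 2 ≤ n ∨ A ⊆ {(p : X)}) {m : ℕ} (hm : 0 < m) (f : CubeMap n m A p) :
    inv h (mk hm f) = mk hm (reverse h hm f) := rfl

theorem star_assoc (h : 2 ≤ n ∨ A ⊆ {(p : X)}) (a b c : RelPi n A p) :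
    mul h (mul h a b) c = mul h a (mul h b c) := by
  obtain ⟨m₁, h1, f₁, rfl⟩ := exists_rep a
  obtain ⟨m₂, h2, f₂, rfl⟩ := exists_rep b
  obtain ⟨m₃, h3, f₃, rfl⟩ := exists_rep c
  rw [mul_mk, mul_mk, mul_mk, mul_mk]
  refine mk_eq_of_spread (funext fun x => ?_)
  rw [spread_star, spread_star, spread_star, spread_star]
  rw [shift_zero]
  have e : shift ((m₁ + m₂ : ℕ) : ℤ) x = shift m₂ (shift m₁ x) := by
    funext i
    by_cases hi : i = 0
    · subst hi
      simp only [shift_zero]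
      push_cast
      ring
    · simp only [shift_ne _ _ hi]
  rw [e]
  push_cast
  split_ifs <;> first | rfl | omega

theorem one_star (h : 2 ≤ n ∨ A ⊆ {(p : X)}) (a : RelPi n A p) : mul h 1 a = a := by
  obtain ⟨m, hm, f, rfl⟩ := exists_rep a
  change mul h (mk one_pos _) _ = _
  rw [mul_mk]
  have hle : m ≤ 1 + m := by omega
  rw [← mk_comp_retraction hm hle f]
  refine mk_eq_of_reparam h hm _ hle f _ _ (fun a => a - 1) id ?_ ?_ ?_ ?_ ?_ ?_ ?_
  · intro a b hab
    simpa using hab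
  · exact fun a b hab => hab
  · intro a
    simp
  · intro x
    rw [← spread_coe (star h _ _ _ _)]
    rw [spread_star]
    have e : shift ((1 : ℕ) : ℤ) (fun i => (x i : ℤ)) =
        Function.update (fun i => (x i : ℤ)) 0 (x 0 - 1) := by
      funext i
      by_cases hi : i = 0
      · subst hi
        simp [shift_zero]
      · simp [shift_ne _ _ hi, hi]
    rw [e]
    split_ifs with h0
    · refine (spread_eq_zero h hm f (Or.inl ?_)).symm
      rw [Function.update_self]
      simpa using h0
    · rfl
  · intro x
    rw [← spread_coe (TripleMap.comp _ _), spread_comp_retraction]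
    congr 1
    funext i
    by_cases hi : i = 0
    · subst hi
      simp
    · simp [hi]
  · exact Or.inl le_rfl
  · refine Or.inr ?_
    push_cast
    simp

theorem inv_star (h : 2 ≤ n ∨ A ⊆ {(p : X)}) (a : RelPi n A p) : mul h (inv h a) a = 1 := by
  obtain ⟨m, hm, f, rfl⟩ := exists_rep a
  rw [inv_mk, mul_mk, one_eq (Nat.add_pos_left hm m)]
  have hle : m ≤ m + m := by omega
  refine mk_eq_of_reparam h hm _ hle f _ _ (fun a => |a - m|) (fun a => max |a - m| m)
    ?_ ?_ ?_ ?_ ?_ ?_ ?_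
  · intro a b hab
    rw [abs_le] at hab
    simp only [abs_eq_max_neg]
    omega
  · intro a b hab
    rw [abs_le] at hab
    simp only [abs_eq_max_neg]
    omega
  · intro a
    exact le_max_left _ _
  · intro x
    rw [← spread_coe (star h _ _ _ _)]
    rw [spread_star]
    split_ifs with h0
    · change reverse h hm f _ = _
      rw [reverse_apply]
      refine f.spread_congr fun i => ?_
      by_cases hi : i = 0
      · subst hi
        rw [Function.update_self, Function.update_self, coe_clip, abs_eq_max_neg]
        have := (x 0).2.1
        omega
      · rw [Function.update_of_ne hi, Function.update_of_ne hi, coe_clip]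
        omega
    · refine f.spread_congr fun i => ?_
      by_cases hi : i = 0
      · subst hi
        rw [Function.update_self, shift_zero, abs_eq_max_neg]
        omega
      · rw [Function.update_of_ne hi, shift_ne _ _ hi]
  · intro x
    refine (spread_eq_zero h hm f (Or.inr ?_)).symm
    rw [Function.update_self]
    exact le_max_right _ _
  · refine Or.inr ?_
    simp
  · refine Or.inr ?_
    push_cast
    simp

/-- The group structure on `π_n(X, A, p)`, for `n ≥ 2` or `A = {p}`. -/
@[reducible] noncomputable def group (h : 2 ≤ n ∨ A ⊆ {(p : X)}) : Group (RelPi n A p) where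
  mul := mul h
  one := 1
  inv := inv h
  mul_assoc := star_assoc h
  one_mul := one_star h
  mul_one := (@Group.ofLeftAxioms _ ⟨mul h⟩ ⟨inv h⟩ _ (star_assoc h) (one_star h)
    (inv_star h)).mul_one
  inv_mul_cancel := inv_star h

/-- For `n ≥ 2`, `π_n(X, A, p)` is a group under `⋆`. -/
noncomputable instance [n.AtLeastTwo] : Group (RelPi n A p) :=
  group (Or.inl Nat.AtLeastTwo.prop)

theorem map_mul {B : Set Y} {q : B} (g : TripleMap A {(p : X)} B {(q : Y)})
    (h : 2 ≤ n ∨ A ⊆ {(p : X)}) (h' : 2 ≤ n ∨ B ⊆ {(q : Y)}) (a b : RelPi n A p) :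
    map n g (mul h a b) = mul h' (map n g a) (map n g b) := by
  obtain ⟨m, hm, f, rfl⟩ := exists_rep a
  obtain ⟨m', hm', f', rfl⟩ := exists_rep b
  rw [mul_mk, map_mk, map_mk, map_mk, mul_mk]
  exact congrArg _ (TripleMap.ext fun x => apply_ite g _ _ _)

end RelPi

/-- The set `π_n(X, p) = π_n(X, {p}, p)`, `n ≥ 1`. -/
def AbsPi (n : ℕ) (p : X) : Type _ := RelPi n ({p} : Set X) ⟨p, rfl⟩

/-- The element `⟨f⟩` of `π_n(X, p)` represented by `f`. -/
def AbsPi.mk {n m : ℕ} {p : X} (hm : 0 < m) (f : CubeMap n m ({p} : Set X) ⟨p, rfl⟩) : AbsPi n p :=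
  RelPi.mk hm f

/-- For `n ≥ 1`, `π_n(X, p)` is a group under `⋆`. -/
noncomputable instance (n : ℕ) [NeZero n] (p : X) : Group (AbsPi n p) :=
  RelPi.group (Or.inr subset_rfl)

/-- The map `π_n(A, p) → π_n(X, p)` induced by the inclusion of `A` in `X`. -/
def iStar (n : ℕ) (p : A) : AbsPi n p → AbsPi n (p : X) :=
  RelPi.map n
    { toFun := Subtype.val
      bornologous := bornologous_val A
      mapsTo_fst := by rintro _ rfl; rfl
      mapsTo_snd := by rintro _ rfl; rfl }

/-- The map `π_n(X, p) → π_n(X, A, p)` induced by the inclusion of `(X, p)` in `(X, A)`. -/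
def jStar (n : ℕ) (p : A) : AbsPi n (p : X) → RelPi n A p :=
  RelPi.map n
    { toFun := id
      bornologous := bornologous_id
      mapsTo_fst := by rintro _ rfl; exact p.2
      mapsTo_snd := by rintro _ rfl; rfl }

theorem iStar_mul (n : ℕ) [NeZero n] (p : A) (a b : AbsPi n p) :
    iStar n p (a * b) = iStar n p a * iStar n p b := RelPi.map_mul _ _ _ a b

theorem jStar_mul (n : ℕ) [n.AtLeastTwo] (p : A) (a b : AbsPi n (p : X)) :
    jStar n p (a * b) = jStar n p a * jStar n p b := RelPi.map_mul _ _ _ a b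

theorem jStar_one (n : ℕ) [NeZero n] (p : A) : jStar n p 1 = 1 := rfl

/-- The restriction of `f : (I_m^{n+1}, ∂I_m^{n+1}, J_m^n) → (X, A, p)` to the face
`I_m^n × {0}`, as a map `(I_m^n, ∂I_m^n) → (A, p)`. -/
def CubeMap.face {n m : ℕ} (f : CubeMap (n + 1) m A p) :
    CubeMap n m ({p} : Set A) ⟨p, rfl⟩ :=
  have hb : ∀ x ∈ boundary n m,
      f (Fin.snoc x (⟨0, le_rfl, by positivity⟩ : Interval m)) = (p : X) := by
    rintro x ⟨i, hi⟩
    refine f.mapsTo_snd ⟨⟨i.castSucc, by simpa using hi⟩, ?_⟩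
    rintro l hl -
    refine ⟨i.castSucc, fun h => ?_, by simpa using hi⟩
    subst h
    simp at hl
    omega
  { toFun := fun x => ⟨f (Fin.snoc x (⟨0, le_rfl, by positivity⟩ : Interval m)),
      f.mapsTo_fst ⟨Fin.last n, Or.inl (by simp)⟩⟩
    bornologous := Bornologous.codRestrict (f.bornologous.comp (Bornologous.pi fun i => by
      induction i using Fin.lastCases with
      | last => simpa using bornologous_const _
      | cast i => simpa using bornologous_apply i)) _
    mapsTo_fst := fun x hx => Subtype.ext (hb x hx)
    mapsTo_snd := fun x hx => Subtype.ext (hb x hx.1) }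

end Groups

end SemiCoarse

namespace SemiCoarse

open SemiCoarseSpace Set

section LongExactSequence

variable {n : ℕ} {X : Type*} [SemiCoarseSpace X] {A : Set X} {p : A}

/-! The argument is the classical one for pairs of spaces, with integer cubes and integer time.
Finiteness makes it elementary: a map with finite range is bornologous as soon as it preserves
adjacency of single pairs, and a homotopy on a finite cube has only finitely many distinct stages.
Homotopies can therefore be written as formulas on `ℤ^n × ℤ`. Adjacent points may differ by one in
every coordinate and in time simultaneously, so the deformations combine a coordinate and the time
by `min` and `max`; a sum could jump by two. Cubes of different sizes are compared through `spread`,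
which the transition maps leave unchanged.

Consecutive maps compose to the trivial one because the last coordinate can be traded for time. A
relative cube, read with its last coordinate as time, contracts its bottom face in `X`
(`iStar_face`). A cube inside `A` is pushed out through its last coordinate without leaving `A`
(`jStar_iStar`). The bottom face of an absolute cube is constant (`face_jStar`).

Conversely, a null-homotopy supplies the preimage. One of `i ∘ f` is itself a relative cube with
face `f` (`exists_face_eq_of_iStar_eq_one`). One of `j ∘ f` sweeps its bottom face through `A`; the
resulting cube in `A` is homotopic to `f` in `X`, as both are slices of the same homotopy
(`exists_iStar_eq_of_jStar_eq_one`). One of the face of `f` in `A`, glued below `f`, makes the whole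
boundary constant without changing the relative class (`exists_jStar_eq_of_face_eq_one`). -/

/-! ### Adjacency, and the faces of a cube -/

theorem adj_val {a b : A} : IsControlled {(a, b)} ↔ IsControlled {((a : X), (b : X))} := by
  refine ⟨(bornologous_val A).adj, fun h => ⟨_, h, ?_⟩⟩
  ext ⟨c, d⟩
  simp [Subtype.ext_iff]

theorem adj_prod_int {Y : Type*} [SemiCoarseSpace Y] {x y : Y} {z w : ℤ}
    (h : IsControlled {(x, y)}) (hzw : |z - w| ≤ 1) : IsControlled {((x, z), (y, w))} := by
  refine ⟨1, fun _ => {(x, y)}, fun _ => {(z, w)}, fun _ => h, fun _ => ?_, ?_⟩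
  · rintro _ rfl
    exact hzw
  · rintro _ rfl
    simp

theorem adj_clip (m : ℕ) {x y : Fin n → ℤ} (h : ∀ i, |x i - y i| ≤ 1) :
    IsControlled {(clip m x, clip m y)} := by
  refine adj_cube.2 fun i => ?_
  have := h i
  rw [abs_le] at *
  rw [coe_clip, coe_clip]
  omega

theorem abs_snoc_sub_snoc_le {x y : Fin n → ℤ} {a b : ℤ} (h : ∀ i, |x i - y i| ≤ 1)
    (hab : |a - b| ≤ 1) (i : Fin (n + 1)) :
    |(Fin.snoc x a : Fin (n + 1) → ℤ) i - (Fin.snoc y b : Fin (n + 1) → ℤ) i| ≤ 1 := by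
  induction i using Fin.lastCases with
  | last => simpa using hab
  | cast i => simpa using h i

theorem abs_update_sub_update_le {x y : Fin n → ℤ} {a b : ℤ} (j : Fin n)
    (h : ∀ i, |x i - y i| ≤ 1) (hab : |a - b| ≤ 1) (i : Fin n) :
    |Function.update x j a i - Function.update y j b i| ≤ 1 := by
  by_cases hi : i = j
  · subst hi
    simpa using hab
  · simpa [hi] using h i

theorem mem_boundary_succ {m : ℕ} {x : Cube (n + 1) m} (hx : x ∈ boundary (n + 1) m) :
    (∃ i : Fin n, (x i.castSucc : ℤ) = 0 ∨ (x i.castSucc : ℤ) = m) ∨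
      (x (Fin.last n) : ℤ) = 0 ∨ (x (Fin.last n) : ℤ) = m := by
  obtain ⟨i, hi⟩ := hx
  induction i using Fin.lastCases with
  | last => exact Or.inr hi
  | cast i => exact Or.inl ⟨i, hi⟩

/-- The open box is covered by all closed faces except the bottom one, where the last coordinate
vanishes. This splits the coordinates as `Fin.snoc` does. -/
theorem mem_openBox_succ {m : ℕ} {x : Cube (n + 1) m} (hx : x ∈ openBox (n + 1) m) :
    (∃ i : Fin n, (x i.castSucc : ℤ) = 0 ∨ (x i.castSucc : ℤ) = m) ∨
      (x (Fin.last n) : ℤ) = m := by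
  rcases openBox_cases hx with ⟨i, hi⟩ | ⟨i, hn, hi⟩ <;>
    induction i using Fin.lastCases with
    | last => first | exact Or.inr hi | simp at hn
    | cast i => exact Or.inl ⟨i, by simp [hi]⟩

/-! ### Boundary values, families of maps and restriction to the bottom face -/

namespace CubeMap

variable {m k : ℕ}

/-- The map on `I_m^n` obtained by restricting a map on `ℤ^n` that preserves adjacency. -/
def ofFun (F : (Fin n → ℤ) → X)
    (hF : ∀ x y, (∀ i, |x i - y i| ≤ 1) → IsControlled {(F x, F y)})
    (hA : ∀ x ∈ boundary n m, F (fun i => x i) ∈ A)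
    (hp : ∀ x ∈ openBox n m, F (fun i => x i) = p) : CubeMap n m A p where
  toFun x := F fun i => x i
  bornologous := bornologous_of_finite_range (toFinite _) fun _ _ h => hF _ _ (adj_cube.1 h)
  mapsTo_fst := hA
  mapsTo_snd := hp

theorem spread_castSucc (hm : 0 < m) (f : CubeMap (n + 1) m A p) {x : Fin (n + 1) → ℤ} (i : Fin n)
    (h : x i.castSucc ≤ 0 ∨ m ≤ x i.castSucc) : f.spread x = p :=
  f.spread_eq hm i.castSucc (h.symm.imp_right fun h => ⟨h, by simp; omega⟩)

theorem spread_last (hm : 0 < m) (f : CubeMap (n + 1) m A p) {x : Fin (n + 1) → ℤ}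
    (h : m ≤ x (Fin.last n)) : f.spread x = p :=
  f.spread_eq hm (Fin.last n) (Or.inl h)

/-- In the absolute case the bottom face also goes to the base point, whereas a relative map only
sends it into `A`. The proof is membership in the singleton. -/
theorem spread_absolute {q : X} (f : CubeMap n m ({q} : Set X) ⟨q, rfl⟩) {x : Fin n → ℤ}
    (i : Fin n) (h : x i ≤ 0 ∨ m ≤ x i) : f.spread x = q :=
  f.spread_mem i h

theorem spread_face (f : CubeMap (n + 1) m A p) (y : Fin n → ℤ) :
    (f.face.spread y : X) = f.spread (Fin.snoc y 0 : Fin (n + 1) → ℤ) := by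
  refine congrArg f (funext fun i => Subtype.ext ?_)
  induction i using Fin.lastCases with
  | last => simp [coe_clip]
  | cast i => simp [coe_clip]

theorem coe_face (f : CubeMap (n + 1) m A p) (y : Cube n m) :
    (f.face y : X) = f.spread (Fin.snoc (fun i => (y i : ℤ)) 0 : Fin (n + 1) → ℤ) := by
  rw [← spread_face, spread_coe]

/-- A homotopy between maps on cubes, as a family of such maps indexed by the time. -/
theorem exists_family {u v : CubeMap n m A p} (h : Homotopic u v) :
    ∃ (T : ℕ) (H : ℤ → CubeMap n m A p), (∀ z ≤ 0, H z = u) ∧ (∀ z : ℤ, T ≤ z → H z = v) ∧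
      ∀ x y z w, (∀ i, |x i - y i| ≤ 1) → |z - w| ≤ 1 →
        IsControlled {((H z).spread x, (H w).spread y)} := by
  obtain ⟨H, hH, ⟨M, N, hMN, h0, h1⟩, hA, hp⟩ := h
  -- Time is translated by `M`, so that the homotopy starts at `0` and is over after `N - M` steps.
  refine ⟨(N - M).toNat, fun z => ⟨fun x => H (x, z + M),
    hH.comp (bornologous_id.prodMk (bornologous_const _)), fun x hx => hA x hx _,
    fun x hx => hp x hx _⟩, fun z hz => TripleMap.ext fun x => h0 x _ (by omega),
    fun z hz => TripleMap.ext fun x => h1 x _ (by omega), fun x y z w hxy hzw => ?_⟩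
  exact hH.adj (adj_prod_int (adj_clip m hxy) (by simpa using hzw))

theorem face_homotopic {u v : CubeMap (n + 1) m A p} (h : Homotopic u v) :
    Homotopic u.face v.face := by
  obtain ⟨T, H, h0, h1, hadj⟩ := exists_family h
  refine homotopic_of (fun x z => (H z).face x) T (fun x z hz => by rw [h0 z hz])
    (fun x z hz => by rw [h1 z hz]) (fun x y z w hxy hzw => ?_)
    (fun x hx z => (H z).face.mapsTo_fst hx) (fun x hx z => (H z).face.mapsTo_snd hx)
  rw [adj_val, coe_face, coe_face]
  exact hadj _ _ _ _ (abs_snoc_sub_snoc_le hxy (by simp)) hzw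

/-- Juxtaposition acts on the first coordinate and restriction on the last; in dimension at least
two these differ, so the operations commute. The side conditions `h` and `h'` hold for different
reasons: the dimension above, the one-point subset below. -/
theorem face_star {m' : ℕ} (h : 2 ≤ n + 2 ∨ A ⊆ {(p : X)}) (h' : 2 ≤ n + 1 ∨ {p} ⊆ ({p} : Set A))
    (hm : 0 < m) (hm' : 0 < m') (f : CubeMap (n + 2) m A p) (g : CubeMap (n + 2) m' A p) :
    (star h hm hm' f g).face = star (A := ({p} : Set A)) (p := ⟨p, rfl⟩) h' hm hm' f.face g.face := by
  refine TripleMap.ext fun x => Subtype.ext ?_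
  rw [coe_face, ← spread_coe (star _ _ _ _ _), spread_star, spread_star]
  have h0 : (Fin.snoc (fun i => (x i : ℤ)) 0 : Fin (n + 2) → ℤ) 0 = x 0 :=
    Fin.snoc_castSucc (α := fun _ => ℤ) 0 _ 0
  rw [apply_ite Subtype.val, spread_face, spread_face, h0]
  congr 2
  funext i
  induction i using Fin.lastCases with
  | last => simp [shift, Fin.last_eq_zero_iff]
  | cast i => simp [shift, Fin.castSucc_eq_zero_iff]

end CubeMap

/-! ### Equality of classes in the direct limit -/

namespace RelPi

open CubeMap

/-- Equality in a direct limit is already equality at some stage, here on a cube of side `k`. -/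
theorem exists_homotopic_of_mk_eq {m m' : ℕ} {hm : 0 < m} {hm' : 0 < m'} {f : CubeMap n m A p}
    {g : CubeMap n m' A p} (h : mk hm f = mk hm' g) :
    ∃ (k : ℕ) (hk : m ≤ k) (hk' : m' ≤ k),
      Homotopic (f.comp (retraction n hm hk)) (g.comp (retraction n hm' hk')) := by
  obtain ⟨k, hk, hk', e⟩ := Quotient.exact h
  exact ⟨k, hk, hk', Quotient.exact e⟩

/-- A representative of the base point is null-homotopic on a larger cube. -/
theorem exists_family_of_mk_eq_one {m : ℕ} {hm : 0 < m} {f : CubeMap n m A p}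
    (h : mk hm f = 1) :
    ∃ (k T : ℕ) (H : ℤ → CubeMap n k A p), m ≤ k ∧ (∀ z ≤ 0, (H z).spread = f.spread) ∧
      (∀ z : ℤ, T ≤ z → ∀ x, (H z).spread x = p) ∧
      ∀ x y z w, (∀ i, |x i - y i| ≤ 1) → |z - w| ≤ 1 →
        IsControlled {((H z).spread x, (H w).spread y)} := by
  obtain ⟨k, hk, hk', e⟩ := exists_homotopic_of_mk_eq h
  obtain ⟨T, H, h0, h1, hadj⟩ := exists_family e
  refine ⟨k, T, H, hk, fun z hz => ?_, fun z hz x => ?_, hadj⟩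
  · rw [h0 z hz, spread_comp_retraction]
  · rw [h1 z hz]
    rfl

/-- A homotopy given by a family of maps on `ℤ^n` identifies the classes of its ends. -/
theorem mk_eq_of_family {m m' k : ℕ} (hm : 0 < m) (hm' : 0 < m') (hk : m ≤ k) (hk' : m' ≤ k)
    (f : CubeMap n m A p) (g : CubeMap n m' A p) (H : (Fin n → ℤ) → ℤ → X) (T : ℕ)
    (h0 : ∀ x : Cube n k, ∀ z ≤ 0, H (fun i => x i) z = f.spread fun i => x i)
    (hT : ∀ x : Cube n k, ∀ z : ℤ, T ≤ z → H (fun i => x i) z = g.spread fun i => x i)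
    (hadj : ∀ x y z w, (∀ i, |x i - y i| ≤ 1) → |z - w| ≤ 1 → IsControlled {(H x z, H y w)})
    (hA : ∀ x ∈ boundary n k, ∀ z, H (fun i => x i) z ∈ A)
    (hp : ∀ x ∈ openBox n k, ∀ z, H (fun i => x i) z = p) : mk hm f = mk hm' g := by
  rw [← mk_comp_retraction hm hk, ← mk_comp_retraction hm' hk']
  refine sound _ (homotopic_of (fun x z => H (fun i => x i) z) T ?_ ?_
    (fun x y z w => hadj _ _ z w) hA hp)
  · intro x z hz
    rw [h0 x z hz, ← spread_comp_retraction hm hk, spread_coe]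
  · intro x z hz
    rw [hT x z hz, ← spread_comp_retraction hm' hk', spread_coe]

/-! ### The boundary homomorphism and the induced maps -/

/-- The boundary map `⟨f⟩ ↦ ⟨f|_{I_m^n × {0}}⟩`. -/
def face : RelPi (n + 1) A p → AbsPi n p :=
  DirectLimit.lift _
    (fun m => Quotient.lift (fun f => AbsPi.mk m.pos (CubeMap.face f))
      fun _ _ h => sound m.pos (face_homotopic h))
    (by
      intro m k h x
      induction x using Quotient.inductionOn with
      | h f =>
        refine mk_eq_of_spread (funext fun x => Subtype.ext ?_)
        rw [spread_face, spread_face, spread_comp_retraction])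

theorem face_mk {m : ℕ} (hm : 0 < m) (f : CubeMap (n + 1) m A p) :
    face (mk hm f) = AbsPi.mk hm f.face := rfl

theorem face_mul (a b : RelPi (n + 2) A p) : face (a * b) = face a * face b := by
  obtain ⟨m, hm, f, rfl⟩ := exists_rep a
  obtain ⟨m', hm', g, rfl⟩ := exists_rep b
  have h : 2 ≤ n + 2 ∨ A ⊆ {(p : X)} := Or.inl (by omega)
  have h' : 2 ≤ n + 1 ∨ {p} ⊆ ({p} : Set A) := Or.inr subset_rfl
  -- Both group laws unfold to `mul`; proof irrelevance allows the side conditions `h` and `h'` in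
  -- place of those in the instances.
  change face (mul h _ _) = mul (A := ({p} : Set A)) (p := ⟨p, rfl⟩) h' (mk hm f.face)
    (mk hm' g.face)
  rw [mul_mk, mul_mk, face_mk, face_star h h']
  rfl

/-- The boundary homomorphism `π_{n+2}(X, A, p) → π_{n+1}(A, p)`. -/
noncomputable def boundaryHom (n : ℕ) (A : Set X) (p : A) :
    RelPi (n + 2) A p →* AbsPi (n + 1) p :=
  MonoidHom.mk' face face_mul

/-- Keeps the composite opaque and records only its values, which is what the homotopy formulas use;
likewise for `iStar_mk`. -/
theorem jStar_mk {m : ℕ} (hm : 0 < m) (f : CubeMap n m ({(p : X)} : Set X) ⟨p, rfl⟩) :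
    ∃ g : CubeMap n m A p, g.spread = f.spread ∧ jStar n p (AbsPi.mk hm f) = mk hm g :=
  ⟨TripleMap.comp _ f, rfl, rfl⟩

theorem iStar_mk {m : ℕ} (hm : 0 < m) (f : CubeMap n m ({p} : Set A) ⟨p, rfl⟩) :
    ∃ g : CubeMap n m ({(p : X)} : Set X) ⟨p, rfl⟩, (∀ x, g.spread x = f.spread x) ∧
      iStar n p (AbsPi.mk hm f) = AbsPi.mk hm g :=
  ⟨TripleMap.comp _ f, fun _ => rfl, rfl⟩

/-! ### Consecutive maps compose to the trivial map -/

theorem face_jStar (a : AbsPi (n + 2) (p : X)) : face (jStar (n + 2) p a) = 1 := by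
  obtain ⟨m, hm, f, rfl⟩ := exists_rep a
  obtain ⟨g, hg, e⟩ := jStar_mk hm f
  refine (congrArg face e).trans ?_
  rw [face_mk]
  refine Eq.trans (mk_eq_of_spread (funext fun x => Subtype.ext ?_)) (one_eq hm).symm
  rw [spread_face, hg]
  exact f.spread_absolute (Fin.last _) (by simp)

/-- The cube `f` is itself the null-homotopy: with its last coordinate read as time, it starts at
the bottom face, ends at the constant top face, and is constant on the sides. -/
theorem iStar_face (a : RelPi (n + 2) A p) : iStar (n + 1) p (face a) = 1 := by
  obtain ⟨m, hm, f, rfl⟩ := exists_rep a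
  rw [face_mk]
  obtain ⟨g, hg, e⟩ := iStar_mk hm f.face
  refine e.trans (Eq.trans ?_ (one_eq hm).symm)
  have side : ∀ x ∈ boundary (n + 1) m, ∀ z : ℤ,
      f.spread (Fin.snoc (fun i => (x i : ℤ)) z : Fin (n + 2) → ℤ) = p := by
    rintro x ⟨i, hi⟩ z
    exact f.spread_castSucc hm i (by simp only [Fin.snoc_castSucc]; omega)
  refine mk_eq_of_family hm hm le_rfl le_rfl g _
    (fun x z => f.spread (Fin.snoc x z : Fin (n + 2) → ℤ)) m (fun x z hz => ?_)
    (fun x z hz => f.spread_last hm (by simpa using hz))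
    (fun x y z w hxy hzw => f.spread_adj (abs_snoc_sub_snoc_le hxy hzw))
    side (fun x hx z => side x hx.1 z)
  rw [hg, spread_face]
  refine f.spread_congr fun i => ?_
  induction i using Fin.lastCases with
  | last => simp only [Fin.snoc_last]; omega
  | cast i => simp

/-- Replacing the last coordinate by its maximum with the time pushes the cube through its top face.
The bottom face moves during this, but only inside `A`, as a relative homotopy permits. -/
theorem jStar_iStar (a : AbsPi (n + 1) p) : jStar (n + 1) p (iStar (n + 1) p a) = 1 := by
  obtain ⟨m, hm, f, rfl⟩ := exists_rep a
  obtain ⟨g, hg, e⟩ := iStar_mk hm f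
  obtain ⟨g', hg', e'⟩ := jStar_mk hm g
  refine (congrArg (jStar (n + 1) p) e).trans (e'.trans (Eq.trans ?_ (one_eq hm).symm))
  refine mk_eq_of_family hm hm le_rfl le_rfl g' _
    (fun x z => f.spread (Function.update x (Fin.last n) (max (x (Fin.last n)) z))) m
    (fun x z hz => ?_) (fun x z hz => ?_) (fun x y z w hxy hzw => ?_)
    (fun x hx z => Subtype.prop _) (fun x hx z => ?_)
  · rw [max_eq_left (hz.trans (x _).2.1), Function.update_eq_self, hg', hg]
  · exact congrArg Subtype.val (f.spread_absolute (Fin.last n) (by simp [hz]))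
  · refine adj_val.1 (f.spread_adj (abs_update_sub_update_le _ hxy ?_))
    have := hxy (Fin.last n)
    rw [abs_le] at *
    omega
  · refine congrArg Subtype.val ?_
    rcases mem_openBox_succ hx with ⟨i, hi⟩ | hi
    · exact f.spread_absolute i.castSucc (by simp; omega)
    · exact f.spread_absolute (Fin.last n) (by simp [hi])

/-! ### Kernels are contained in images -/

/-- A null-homotopy in `X` of the cube in `A`, with time as a new last coordinate, is a relative
cube whose bottom face is the given cube. -/
theorem exists_face_eq_of_iStar_eq_one (a : AbsPi (n + 1) p) (h : iStar (n + 1) p a = 1) :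
    ∃ b : RelPi (n + 2) A p, face b = a := by
  obtain ⟨m, hm, f, rfl⟩ := exists_rep a
  obtain ⟨g, hg, e⟩ := iStar_mk hm f
  obtain ⟨k, T, H, hk, h0, h1, hadj⟩ := exists_family_of_mk_eq_one (e.symm.trans h)
  -- The new cube needs one side length for space and time: at least `k` to contain the spatial
  -- cubes, at least `T` for the homotopy to finish.
  have hk' : k ≤ max k T := le_max_left _ _
  have hT : T ≤ max k T := le_max_right _ _
  -- Off the bottom face the boundary goes to `p`: on the sides because the homotopy fixes the
  -- boundary, on top because it has ended.
  have hF : ∀ x ∈ boundary (n + 2) (max k T), (x (Fin.last _) : ℤ) ≠ 0 →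
      (H (x (Fin.last _))).spread (Fin.init fun i => (x i : ℤ)) = p := by
    intro x hx hl
    rcases mem_boundary_succ hx with ⟨i, hi⟩ | hi
    · exact (H _).spread_absolute i (by simp only [Fin.init]; omega)
    · exact h1 _ (by omega) _
  let F : CubeMap (n + 2) (max k T) A p := ofFun
    (fun x => (H (x (Fin.last _))).spread (Fin.init x))
    (fun x y hxy => hadj _ _ _ _ (fun i => hxy i.castSucc) (hxy (Fin.last _)))
    (fun x hx => by
      by_cases hl : (x (Fin.last _) : ℤ) = 0
      · rw [h0 _ hl.le, hg]
        exact Subtype.prop _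
      · rw [hF x hx hl]
        exact p.2)
    (fun x hx => by
      rcases mem_openBox_succ hx with ⟨i, hi⟩ | hi
      · exact (H _).spread_absolute i (by simp only [Fin.init]; omega)
      · exact h1 _ (show (T : ℤ) ≤ x (Fin.last _) by omega) _)
  refine ⟨mk (show 0 < max k T by omega) F, ?_⟩
  rw [face_mk]
  refine mk_eq_of_spread (funext fun x => Subtype.ext ?_)
  rw [spread_face]
  change (H _).spread _ = _
  rw [h0 _ (by simp [coe_clip]), hg]
  refine congrArg Subtype.val (f.spread_congr fun i => ?_)
  simp only [Fin.init, coe_clip, Fin.snoc_castSucc]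
  omega

/-- In the plane of last coordinate `s` and time `t`, the null-homotopy shows `f` on the axis `t =
0` and a cube in `A` on the axis `s = 0`. Moving from one axis to the other gives the homotopy. -/
theorem exists_iStar_eq_of_jStar_eq_one (a : AbsPi (n + 1) (p : X))
    (h : jStar (n + 1) p a = 1) : ∃ b : AbsPi (n + 1) p, iStar (n + 1) p b = a := by
  obtain ⟨m, hm, f, rfl⟩ := exists_rep a
  obtain ⟨g, hg, e⟩ := jStar_mk hm f
  obtain ⟨k, T, H, hk, h0, h1, hadj⟩ := exists_family_of_mk_eq_one (e.symm.trans h)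
  have hk0 : 0 < k := by omega
  have hK0 : 0 < max k T := by omega
  -- the sheet swept out by the homotopy over the last coordinate
  let S (x : Fin (n + 1) → ℤ) (s t : ℤ) : X := (H t).spread (Function.update x (Fin.last n) s)
  have hS : ∀ x y s t s' t', (∀ i, |x i - y i| ≤ 1) → |s - s'| ≤ 1 → |t - t'| ≤ 1 →
      IsControlled {(S x s t, S y s' t')} := fun x y s t s' t' hxy hs ht =>
    hadj _ _ _ _ (abs_update_sub_update_le _ hxy hs) ht
  have S_side : ∀ (x : Cube (n + 1) (max k T)) (i : Fin n) s t,
      ((x i.castSucc : ℤ) = 0 ∨ (x i.castSucc : ℤ) = (max k T : ℕ)) →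
      S (fun i => x i) s t = p := fun x i s t hi =>
    (H t).spread_castSucc hk0 i (by simp; omega)
  have S_time : ∀ x s (t : ℤ), T ≤ t → S x s t = p := fun x s t ht => h1 t ht _
  have S_top : ∀ x (s : ℤ) t, k ≤ s → S x s t = p := fun x s t hs =>
    (H t).spread_last hk0 (by simpa using hs)
  have S_start : ∀ x s t, t ≤ 0 → S x s t = f.spread (Function.update x (Fin.last n) s) :=
    fun x s t ht => by
      rw [← hg, ← h0 t ht]
  -- At nonpositive times the map is still `f`, which is absolute and so constant on its bottom face
  -- too; at later times that face is only known to lie in `A`.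
  have S_corner : ∀ x s t, s ≤ 0 → t ≤ 0 → S x s t = p := fun x s t hs ht => by
    rw [S_start x s t ht]
    exact f.spread_absolute (Fin.last n) (by simp [hs])
  have S_mem : ∀ x s t, s ≤ 0 → S x s t ∈ A := fun x s t hs =>
    (H t).spread_mem (Fin.last n) (Or.inl (by simpa using hs))
  have side : ∀ x ∈ boundary (n + 1) (max k T), S (fun i => x i) 0 (x (Fin.last n)) = p := by
    intro x hx
    rcases mem_boundary_succ hx with ⟨i, hi⟩ | hi | hi
    · exact S_side x i _ _ hi
    · exact S_corner _ _ _ le_rfl hi.le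
    · exact S_time _ _ _ (by omega)
  -- The trace of the bottom face under the homotopy, with time read off the last coordinate.
  let F : CubeMap (n + 1) (max k T) ({p} : Set A) ⟨p, rfl⟩ := ofFun
    (fun x => ⟨S x 0 (x (Fin.last n)), S_mem _ _ _ le_rfl⟩)
    (fun x y hxy => adj_val.2 (hS x y 0 _ 0 _ hxy (by simp) (hxy _)))
    (fun x hx => Subtype.ext (side x hx)) (fun x hx => Subtype.ext (side x hx.1))
  refine ⟨AbsPi.mk hK0 F, ?_⟩
  obtain ⟨G, hG, e'⟩ := iStar_mk hK0 F
  refine e'.trans (Eq.symm ?_)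
  -- With `K = max k T` and `a` the last coordinate, `(s, t)` runs from `(a, 0)` to `(a, a)` for `z`
  -- in `[0, K]`, and on to `(0, a)` for `z` in `[K, 2K]`. For `a = K` the first leg lies on the top
  -- face, since `K ≥ k`, and the second after the end of the homotopy, since `K ≥ T`. For `a = 0`
  -- it stays at the corner.
  have side' : ∀ x ∈ boundary (n + 1) (max k T), ∀ z : ℤ, S (fun i => x i)
      (max 0 (min (x (Fin.last n)) (2 * max k T - z))) (min (x (Fin.last n)) z) = p := by
    intro x hx z
    rcases mem_boundary_succ hx with ⟨i, hi⟩ | hi | hi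
    · exact S_side x i _ _ hi
    · exact S_corner _ _ _ (by omega) (by omega)
    · by_cases hz : z ≤ max k T
      · exact S_top _ _ _ (by omega)
      · exact S_time _ _ _ (by omega)
  refine mk_eq_of_family hm hK0 (hk.trans (le_max_left _ _)) le_rfl f G
    (fun x z => S x (max 0 (min (x (Fin.last n)) (2 * max k T - z))) (min (x (Fin.last n)) z))
    (2 * max k T) (fun x z hz => ?_) (fun x z hz => ?_) (fun x y z w hxy hzw => ?_)
    side' (fun x hx z => side' x hx.1 z)
  · obtain ⟨hl, hu⟩ := (x (Fin.last n)).2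
    have e : max 0 (min (x (Fin.last n) : ℤ) (2 * (max k T : ℕ) - z)) = x (Fin.last n) := by omega
    dsimp only
    rw [e, S_start _ _ _ ((min_le_right _ _).trans hz)]
    exact congrArg f.spread (Function.update_eq_self _ _)
  · obtain ⟨hl, hu⟩ := (x (Fin.last n)).2
    have e : max 0 (min (x (Fin.last n) : ℤ) (2 * (max k T : ℕ) - z)) = 0 := by omega
    have e' : min (x (Fin.last n) : ℤ) z = x (Fin.last n) := by omega
    dsimp only
    rw [e, e', hG, spread_coe]
    rfl
  · have := hxy (Fin.last n)
    refine hS _ _ _ _ _ _ hxy ?_ ?_ <;> rw [abs_le] at * <;> omega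

/-- Gluing the reversed null-homotopy of the face below `f` yields an absolute cube. The added
collar lies in `A`, so it can be slid out through the bottom face by a relative homotopy. -/
theorem exists_jStar_eq_of_face_eq_one (a : RelPi (n + 2) A p) (h : face a = 1) :
    ∃ b : AbsPi (n + 2) (p : X), jStar (n + 2) p b = a := by
  obtain ⟨m, hm, f, rfl⟩ := exists_rep a
  obtain ⟨k, T, H, hk, h0, h1, hadj⟩ := exists_family_of_mk_eq_one (hm := hm) (f := f.face) h
  have hK0 : 0 < k + T := by omega
  -- `f`, preceded in the last direction by the null-homotopy of its face
  let C (x : Fin (n + 1) → ℤ) (t : ℤ) : X :=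
    if t ≤ T then (H (T - t)).spread x else f.spread (Fin.snoc x (t - T) : Fin (n + 2) → ℤ)
  have C_le : ∀ x (t : ℤ), t ≤ T → C x t = (H (T - t)).spread x := fun x t ht => if_pos ht
  -- The two formulas agree at `t = T`, where both give the face of `f`. Since adjacent times lie on
  -- one side of `T`, adjacency can be checked on each piece.
  have C_ge : ∀ x (t : ℤ), T ≤ t → C x t = f.spread (Fin.snoc x (t - T) : Fin (n + 2) → ℤ) := by
    intro x t ht
    rcases ht.eq_or_lt with rfl | ht
    · rw [C_le _ _ le_rfl, sub_self, h0 0 le_rfl]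
      exact f.spread_face x
    · exact if_neg ht.not_ge
  have hC : ∀ x y t s, (∀ i, |x i - y i| ≤ 1) → |t - s| ≤ 1 →
      IsControlled {(C x t, C y s)} := by
    intro x y t s hxy hts
    by_cases hle : t ≤ T ∧ s ≤ T
    · rw [C_le _ _ hle.1, C_le _ _ hle.2]
      exact adj_val.1 (hadj _ _ _ _ hxy (by rw [abs_le] at *; omega))
    · have := abs_le.1 hts
      rw [C_ge _ _ (by omega), C_ge _ _ (by omega)]
      exact f.spread_adj (abs_snoc_sub_snoc_le hxy (by simpa using hts))
  have C_side : ∀ (x : Cube (n + 2) (k + T)) (i : Fin (n + 1)) t,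
      ((x i.castSucc : ℤ) = 0 ∨ (x i.castSucc : ℤ) = (k + T : ℕ)) →
      C (Fin.init fun i => (x i : ℤ)) t = p := by
    intro x i t hi
    by_cases ht : t ≤ T
    · rw [C_le _ _ ht]
      exact congrArg Subtype.val ((H _).spread_absolute i (by simp only [Fin.init]; omega))
    · rw [C_ge _ _ (by omega)]
      exact f.spread_castSucc hm i (by simp only [Fin.init, Fin.snoc_castSucc]; omega)
  have C_top : ∀ x (t : ℤ), (k + T : ℕ) ≤ t → C x t = p := fun x t ht => by
    rw [C_ge _ _ (by omega)]
    exact f.spread_last hm (by simp only [Fin.snoc_last]; omega)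
  have side : ∀ x ∈ boundary (n + 2) (k + T),
      C (Fin.init fun i => (x i : ℤ)) (x (Fin.last _)) = p := by
    intro x hx
    rcases mem_boundary_succ hx with ⟨i, hi⟩ | hi | hi
    · exact C_side x i _ hi
    · rw [C_le _ _ (by omega), h1 _ (by omega)]
    · exact C_top _ _ hi.ge
  let G : CubeMap (n + 2) (k + T) ({(p : X)} : Set X) ⟨p, rfl⟩ := ofFun
    (fun x => C (Fin.init x) (x (Fin.last _)))
    (fun x y hxy => hC _ _ _ _ (fun i => hxy i.castSucc) (hxy _)) side
    (fun x hx => side x hx.1)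
  refine ⟨AbsPi.mk hK0 G, ?_⟩
  obtain ⟨g, hg, e⟩ := jStar_mk hK0 G
  refine e.trans ?_
  -- The last coordinate `a` climbs to `a + T`, taking the glued cube to `f`. The clamp `max a (min
  -- (a + T) z)` changes by at most one when `a` and `z` both do.
  have stretch : ∀ x ∈ openBox (n + 2) (k + T), ∀ z : ℤ, C (Fin.init fun i => (x i : ℤ))
      (max (x (Fin.last _)) (min (x (Fin.last _) + T) z)) = p := by
    intro x hx z
    rcases mem_openBox_succ hx with ⟨i, hi⟩ | hi
    · exact C_side x i _ hi
    · exact C_top _ _ (by omega)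
  refine mk_eq_of_family hK0 hm le_rfl (by omega) g f
    (fun x z => C (Fin.init x) (max (x (Fin.last _)) (min (x (Fin.last _) + T) z)))
    -- The last coordinate is at most `k + T`, so every point has climbed its full `T` by this time.
    (k + T + T) (fun x z hz => ?_) (fun x z hz => ?_) (fun x y z w hxy hzw => ?_)
    (fun x hx z => ?_) stretch
  · have hl := (x (Fin.last _)).2.1
    have e : max (x (Fin.last _) : ℤ) (min (x (Fin.last _) + T) z) = x (Fin.last _) := by omega
    dsimp only
    rw [e, hg, spread_coe]
    rfl
  · obtain ⟨hl, hu⟩ := (x (Fin.last _)).2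
    have e : max (x (Fin.last _) : ℤ) (min (x (Fin.last _) + T) z) = x (Fin.last _) + T := by omega
    dsimp only
    rw [e, C_ge _ _ (by omega), add_sub_cancel_right]
    exact congrArg f.spread (Fin.snoc_init_self (α := fun _ => ℤ) _)
  · have := hxy (Fin.last _)
    refine hC _ _ _ _ (fun i => hxy i.castSucc) ?_
    rw [abs_le] at *
    omega
  -- A point of the bottom face stays at height at most `T`, in the collar, hence in `A`. Any other
  -- boundary point lies in the open box, whose extra condition is vacuous there.
  · by_cases hl : (x (Fin.last _) : ℤ) = 0
    · dsimp only
      rw [C_le _ _ (by omega)]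
      exact Subtype.prop _
    · refine (stretch x ⟨hx, fun l hl' h => (hl ?_).elim⟩ z) ▸ p.2
      rwa [show l = Fin.last _ from Fin.ext (by simpa using hl')] at h

end RelPi

end LongExactSequence

end SemiCoarse

/-- Index `n` treats the terms `π_{n+1}(A)`, `π_{n+1}(X)` and `π_{n+2}(X, A)`, so `n ≥ 0` reaches
every term but `π_1(X, A)`. At `n = 0` the second exactness uses only the base point `1` of that
set. -/
theorem mainTheorem2 {X : Type*} [SemiCoarseSpace X] (A : Set X) (p : A) :
    ∃ boundaryHom : ∀ n : ℕ, SemiCoarse.RelPi (n + 2) A p →* SemiCoarse.AbsPi (n + 1) p,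
      (∀ (n m : ℕ) (hm : 0 < m) (f : SemiCoarse.CubeMap (n + 2) m A p),
        boundaryHom n (SemiCoarse.RelPi.mk hm f) = SemiCoarse.AbsPi.mk hm f.face) ∧
      ∀ n : ℕ,
        Function.MulExact (boundaryHom n) (SemiCoarse.iStar (n + 1) p) ∧
        Function.MulExact (SemiCoarse.iStar (n + 1) p) (SemiCoarse.jStar (n + 1) p) ∧
        Function.MulExact (SemiCoarse.jStar (n + 2) p) (boundaryHom n) := by
  refine ⟨fun n => SemiCoarse.RelPi.boundaryHom n A p, fun n m hm f => rfl, fun n =>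
    ⟨fun a => ⟨SemiCoarse.RelPi.exists_face_eq_of_iStar_eq_one a, ?_⟩,
      fun a => ⟨SemiCoarse.RelPi.exists_iStar_eq_of_jStar_eq_one a, ?_⟩,
      fun a => ⟨SemiCoarse.RelPi.exists_jStar_eq_of_face_eq_one a, ?_⟩⟩⟩
  · rintro ⟨b, rfl⟩
    exact SemiCoarse.RelPi.iStar_face b
  · rintro ⟨b, rfl⟩
    exact SemiCoarse.RelPi.jStar_iStar b
  · rintro ⟨b, rfl⟩
    exact SemiCoarse.RelPi.face_jStar b
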